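/- Let $\mathbb C^{2N}$ have coordinates $a_0,\dots,a_{N-1},a_0^*,\dots,a_{N-1}^*$ and carry the holomorphic Poisson structure $$\{a_i,a_j\}=-a_ia_j\ (i<j),\qquad \{a_i^*,a_j^*\}=a_i^*a_j^*\ (i<j),\qquad \{a_i,a_j^*\}=-a_ia_j^*\ (i\ne j),\qquad \{a_i,a_i^*\}=2\sum_{k>i}a_ka_k^* .$$ A connected integral manifold is a connected complex manifold, injectively and holomorphically immersed in $\mathbb C^{2N}$, whose tangent space at each of its points is the space of values there of the Hamiltonian vector fields. A symplectic leaf is a connected integral manifold that is maximal with respect to inclusion. Let $\underline a\in\mathbb C^{2N}$ and put $\Omega_k=\sum_{j\ge k}a_ja_j^*$. If not all products $a_ia_i^*$ vanish, let $i_0$ be the largest $i$ with $a_ia_i^*\neq0$; let $i_1$ be the largest $i<i_0$ with $\Omega_i=0$, then $i_2$ the largest $i<i_1$ with $\Omega_i\ne0$, then $i_3$ the largest $i<i_2$ with $\Omega_i=0$, and so on, alternately, as long as such an index exists. This gives $N-1\ge i_0>i_1>\dots>i_s\ge0$. Let $r_0$ be the number of non-zero coordinates (starred or unstarred) of $\underline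 a$ with index greater than $i_0$, and for $k\ge1$ with $2k\le s$ let $r_{2k}$ be the number of non-zero coordinates with index strictly between $i_{2k}$ and $i_{2k-1}$. If $s=2l$, put $i_{2l+1}=0$; if $s=2l+1$, define $r_{2l+2}$ by letting $r_{2l+2}+1$ be the number of non-zero coordinates with index smaller than $i_{2l+1}$. If all products $a_ia_i^*$ vanish, let $r_0$ be the number of all non-zero coordinates of $\underline a$. Then there is a symplectic leaf $\mathcal O_{\underline a}$ containing $\underline a$, and its complex dimension is $$\dim\mathcal O_{\underline a}=\begin{cases}2\left[\frac{r_0}{2}\right] & \text{if } a_ia_i^*=0 \text{ for all } i,\\[4pt] \sum_{k=0}^{l}\left(2(i_{2k}-i_{2k+1})+2\left[\frac{r_{2k}+1}{2}\right]\right) & \text{if not all } a_ia_i^*=0 \text{ and } s=2l,\\[4pt] \sum_{k=0}^{l}2(i_{2k}-i_{2k+1})+\sum_{k=0}^{l+1}2\left[\frac{r_{2k}+1}{2}\right] & \text{if not all } a_ia_i^*=0 \text{ and } s=2l+1,\end{cases}$$ where $[\cdot]$ denotes the integer part. -/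

import Mathlib

open scoped Manifold ContDiff

noncomputable section

namespace QPlane

/-- The space `ℂ^{2N}`; the coordinate `Sum.inl i` is `a_i`, the coordinate `Sum.inr i` is `a_i^*`. -/
abbrev Phase (N : ℕ) : Type := Fin N ⊕ Fin N → ℂ

/-- The matrix of Poisson brackets `{x_u, x_v}` of the coordinate functions, at the point `x`. -/
def poissonMatrix {N : ℕ} (x : Phase N) : Fin N ⊕ Fin N → Fin N ⊕ Fin N → ℂ
  | .inl i, .inl j =>
      if i < j then -(x (.inl i) * x (.inl j))
      else if j < i then x (.inl j) * x (.inl i) else 0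
  | .inr i, .inr j =>
      if i < j then x (.inr i) * x (.inr j)
      else if j < i then -(x (.inr j) * x (.inr i)) else 0
  | .inl i, .inr j =>
      if i = j then 2 * ∑ k ∈ Finset.univ.filter (fun k => i < k), x (.inl k) * x (.inr k)
      else -(x (.inl i) * x (.inr j))
  | .inr i, .inl j =>
      if i = j then -(2 * ∑ k ∈ Finset.univ.filter (fun k => j < k), x (.inl k) * x (.inr k))
      else x (.inl j) * x (.inr i)

/-- The partial derivative `∂f/∂x_u` at `x`. -/
def partialDeriv {N : ℕ} (f : Phase N → ℂ) (u : Fin N ⊕ Fin N) (x : Phase N) : ℂ :=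
  fderiv ℂ f x (Pi.single u 1)

/-- The Hamiltonian vector field `{f, ·}` of a function `f` on `ℂ^{2N}`, whose `v`-th component is
`{f, x_v} = ∑ u, {x_u, x_v} ∂f/∂x_u`. -/
def hamiltonianField {N : ℕ} (f : Phase N → ℂ) (x : Phase N) : Phase N :=
  fun v => ∑ u, poissonMatrix x u v * partialDeriv f u x

/-- The distribution defined by the Hamiltonian vector fields of the holomorphic functions. -/
def hamiltonianDistribution {N : ℕ} (x : Phase N) : Submodule ℂ (Phase N) :=
  Submodule.span ℂ {v | ∃ f : Phase N → ℂ, Differentiable ℂ f ∧ v = hamiltonianField f x}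

/-- A connected integral manifold of the Hamiltonian distribution: a connected complex manifold,
injectively immersed in `ℂ^{2N}`, whose tangent space at each of its points is the fibre of the
distribution there. -/
structure IntegralManifold (N : ℕ) where
  /-- the complex dimension -/
  dim : ℕ
  /-- the underlying abstract manifold -/
  M : Type
  [top : TopologicalSpace M]
  [charted : ChartedSpace (Fin dim → ℂ) M]
  [manifold : IsManifold 𝓘(ℂ, Fin dim → ℂ) ω M]
  [connected : ConnectedSpace M]
  /-- the immersion into `ℂ^{2N}` -/
  incl : M → Phase N
  incl_injective : Function.Injective incl
  incl_holomorphic : ContMDiff 𝓘(ℂ, Fin dim → ℂ) 𝓘(ℂ, Phase N) ω incl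
  incl_immersion : ∀ p : M,
    Function.Injective (mfderiv 𝓘(ℂ, Fin dim → ℂ) 𝓘(ℂ, Phase N) incl p)
  tangent_eq : ∀ p : M, ∀ v : Phase N,
    (∃ w : TangentSpace 𝓘(ℂ, Fin dim → ℂ) p,
      mfderiv 𝓘(ℂ, Fin dim → ℂ) 𝓘(ℂ, Phase N) incl p w = v) ↔
    v ∈ hamiltonianDistribution (incl p)

/-- The set of points of `ℂ^{2N}` on an integral manifold. -/
def IntegralManifold.points {N : ℕ} (L : IntegralManifold N) : Set (Phase N) :=
  Set.range L.incl

/-- A symplectic leaf is a maximal connected integral manifold. -/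
def IntegralManifold.IsSymplecticLeaf {N : ℕ} (L : IntegralManifold N) : Prop :=
  ∀ L' : IntegralManifold N, L.points ⊆ L'.points → L'.points = L.points

/-- The partial sum `∑_{j ≥ k} a_j a_j^*`. -/
def partialSum {N : ℕ} (x : Phase N) (k : ℕ) : ℂ :=
  ∑ j ∈ Finset.univ.filter (fun j : Fin N => k ≤ (j : ℕ)), x (.inl j) * x (.inr j)

/-- The sequence `i_0 > i_1 > … > i_s` of the point `x`, continued by zeros beyond `i_s`. -/
structure IsIndexSequence {N : ℕ} (x : Phase N) (s : ℕ) (i : ℕ → ℕ) : Prop where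
  first : IsGreatest {k | ∃ j : Fin N, (j : ℕ) = k ∧ x (.inl j) * x (.inr j) ≠ 0} (i 0)
  odd_step : ∀ t, 2 * t + 1 ≤ s →
    IsGreatest {k | k < i (2 * t) ∧ partialSum x k = 0} (i (2 * t + 1))
  even_step : ∀ t, 2 * t + 2 ≤ s →
    IsGreatest {k | k < i (2 * t + 1) ∧ partialSum x k ≠ 0} (i (2 * t + 2))
  stop_even : ∀ t, s = 2 * t → ∀ k, k < i s → partialSum x k ≠ 0
  stop_odd : ∀ t, s = 2 * t + 1 → ∀ k, k < i s → partialSum x k = 0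
  beyond : ∀ t, s < t → i t = 0

/-- If some product `a_j a_j^*` is non-zero, then the index sequence exists. -/
theorem exists_isIndexSequence {N : ℕ} (x : Phase N)
    (hx : ∃ j : Fin N, x (.inl j) * x (.inr j) ≠ 0) :
    ∃ (s : ℕ) (i : ℕ → ℕ), IsIndexSequence x s i := by
  classical
  have greatest : ∀ (S : Set ℕ) (b : ℕ), S.Nonempty → (∀ k ∈ S, k < b) → ∃ m, IsGreatest S m := by
    intro S b hS hb
    have hfin : S.Finite := (Set.finite_lt_nat b).subset hb
    obtain ⟨m, hm, hmax⟩ := hfin.exists_maximal hS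
    exact ⟨m, hm, fun k hk => (le_total k m).elim id (fun h => hmax hk h)⟩
  -- Any partial sequence can be continued until it stops.
  have extend : ∀ (n s : ℕ) (i : ℕ → ℕ), i s ≤ n →
      IsGreatest {k | ∃ j : Fin N, (j : ℕ) = k ∧ x (.inl j) * x (.inr j) ≠ 0} (i 0) →
      (∀ t, t < s → IsGreatest {k | k < i t ∧ (Even t ↔ partialSum x k = 0)} (i (t + 1))) →
      (∀ t, s < t → i t = 0) → ∃ (s : ℕ) (i : ℕ → ℕ), IsIndexSequence x s i := by
    intro n
    induction n with
    | zero =>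
      intro s i hn h0 hstep hbey
      refine ⟨s, i, h0, ?_, ?_, ?_, ?_, hbey⟩
      · intro t ht
        simpa using hstep (2 * t) (by omega)
      · intro t ht
        have := hstep (2 * t + 1) (by omega)
        simpa [Nat.even_add_one] using this
      · intro t _ k hk; omega
      · intro t _ k hk; omega
    | succ n ih =>
      intro s i hn h0 hstep hbey
      by_cases hne : {k | k < i s ∧ (Even s ↔ partialSum x k = 0)}.Nonempty
      · obtain ⟨m, hm⟩ := greatest _ (i s) hne (fun k hk => hk.1)
        refine ih (s + 1) (Function.update i (s + 1) m) ?_ ?_ ?_ ?_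
        · have := hm.1.1
          simp only [Function.update_self]; omega
        · simpa using h0
        · intro t ht
          rcases Nat.lt_succ_iff_lt_or_eq.mp ht with h | h
          · rw [Function.update_of_ne (by omega), Function.update_of_ne (by omega)]
            exact hstep t h
          · subst h
            rw [Function.update_of_ne (by omega), Function.update_self]
            exact hm
        · intro t ht
          rw [Function.update_of_ne (by omega)]
          exact hbey t (by omega)
      · rw [Set.not_nonempty_iff_eq_empty] at hne
        have hfin : ∀ k, k < i s → ¬ (Even s ↔ partialSum x k = 0) := by
          intro k hk h
          have : k ∈ ({k | k < i s ∧ (Even s ↔ partialSum x k = 0)} : Set ℕ) := ⟨hk, h⟩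
          rw [hne] at this
          exact this
        refine ⟨s, i, h0, ?_, ?_, ?_, ?_, hbey⟩
        · intro t ht
          simpa using hstep (2 * t) (by omega)
        · intro t ht
          have := hstep (2 * t + 1) (by omega)
          simpa [Nat.even_add_one] using this
        · intro t ht k hk
          have := hfin k hk
          subst ht
          simpa using this
        · intro t ht k hk
          have := hfin k hk
          subst ht
          simpa [Nat.even_add_one] using this
  obtain ⟨m, hm⟩ := greatest
    {k | ∃ j : Fin N, (j : ℕ) = k ∧ x (.inl j) * x (.inr j) ≠ 0} N
    (hx.elim fun j hj => ⟨j, j, rfl, hj⟩) (by rintro k ⟨j, rfl, -⟩; exact j.2)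
  refine extend m 0 (fun t => if t = 0 then m else 0) (by simp) (by simpa using hm) ?_ ?_
  · intro t ht; omega
  · intro t ht; simp; omega

open Classical in
/-- The number of non-zero coordinates (starred or unstarred) of `x` with index in `S`. -/
def nonzeroCount {N : ℕ} (x : Phase N) (S : Set ℕ) : ℕ :=
  (Finset.univ.filter (fun j : Fin N => (j : ℕ) ∈ S ∧ x (.inl j) ≠ 0)).card +
  (Finset.univ.filter (fun j : Fin N => (j : ℕ) ∈ S ∧ x (.inr j) ≠ 0)).card

/-- The number `r_{2k}` of non-zero coordinates with index strictly between `i_{2k}` and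
`i_{2k-1}`; for `k = 0` the index is only required to exceed `i_0`. -/
def rEven {N : ℕ} (x : Phase N) (i : ℕ → ℕ) (k : ℕ) : ℕ :=
  nonzeroCount x {j | i (2 * k) < j ∧ (k = 0 ∨ j < i (2 * k - 1))}

end QPlane

end

/-! ### Straightening coordinates for sets with a prescribed tangent space -/

noncomputable section
namespace QPlane
open Filter Topology Set

/-! Kernel of the Poisson tensor. Write `a_k`, `b_k` for the unstarred and starred coordinates and
`(p, q)` for a covector. Put `M_k = ∑_{i<k} (q_i b_i - p_i a_i)` and `H_k = ∑_{i≥k} (p_i a_i + q_i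
b_i)`. The covector is in the kernel iff `a_k (M_k + H_{k+1}) = 2 q_k Ω_{k+1}` and `b_k (H_{k+1} -
M_k) = 2 p_k Ω_{k+1}` for all `k` (`isKernel_iff`). A downward sweep shows that at each place one of
`M_k`, `H_k` vanishes (`IsKernel.state`). Which one is decided by a parity, `Pattern.Ev`: it counts
the non-zero coordinates in the current run of vanishing sums. An upward sweep shows that the other
scalar can be chosen only at the places `Pattern.Act`. In addition `p_k` or `q_k` is free where its
coordinate vanishes and `Ω_k = Ω_{k+1} = 0` (`IsKernel.eq_zero`). This bounds the corank from above.

Each of these freedoms is realised by a function with gradient in the kernel: a vanishing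
coordinate, a partial sum, or a Laurent monomial. These gradients are triangular with respect to the
free scalars, hence independent. So the Hamiltonian distribution is the kernel of the differential
of a submersion, `invariants` (`hamiltonianDistribution_eq_ker`).

Leaves. Points with equal vanishing pattern and equal invariants form a class. Near each of its
points the class is a level set of that submersion, so its connected components are integral
manifolds. Along Hamiltonian directions the derivative of `Ω_k` is a multiple of `Ω_k`, and that of
`a_k`, `b_k` is a multiple of itself wherever `Ω_{k+1} = 0`. By Grönwall these zeros persist along
every integral manifold, while non-zero values persist by continuity. The pattern, and then the
invariants, are locally constant, so a connected integral manifold stays in one class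
(`eventually_leafSetoid`). This gives maximality of the components.

Dimension. It is the rank of the distribution (`IntegralManifold.dim_eq`), that is, `2N` minus the
number of invariants. Charging the invariants to indices (`weight`) and summing over the blocks cut
out by the sequence `i_t` gives the formulas. -/

/-- A holomorphic coordinate system around `y` in which the set `S` is given by the vanishing of the
first component, and in which `D` is the kernel of the first component of the derivative at `y`. -/
structure Flattening {E K F : Type*} [NormedAddCommGroup E] [NormedSpace ℂ E]
    [NormedAddCommGroup K] [NormedSpace ℂ K] [NormedAddCommGroup F] [NormedSpace ℂ F]
    (S : Set E) (D : Submodule ℂ E) (y : E) (φ : OpenPartialHomeomorph E (K × F)) : Prop where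
  mem : y ∈ φ.source
  smooth : ContDiffOn ℂ ω φ φ.source
  smooth_symm : ContDiffOn ℂ ω φ.symm φ.target
  mem_iff : ∀ z ∈ φ.source, z ∈ S ↔ (φ z).1 = 0
  tangent : ∀ v, (fderiv ℂ φ y v).1 = 0 ↔ v ∈ D

section Flattening

variable {E K F : Type*} [NormedAddCommGroup E] [NormedSpace ℂ E] [NormedAddCommGroup K]
  [NormedSpace ℂ K] [NormedAddCommGroup F] [NormedSpace ℂ F]

theorem Flattening.restr {S : Set E} {D : Submodule ℂ E} {y : E}
    {φ : OpenPartialHomeomorph E (K × F)} (h : Flattening S D y φ) {U : Set E} (hU : IsOpen U)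
    (hy : y ∈ U) : Flattening S D y (φ.restrOpen U hU) where
  mem := ⟨h.mem, hy⟩
  smooth := h.smooth.mono inter_subset_left
  smooth_symm := h.smooth_symm.mono (by
    rintro z hz
    exact ((φ.restrOpen U hU).symm.mapsTo hz |> fun h' => by
      simpa using hz.1))
  mem_iff z hz := h.mem_iff z hz.1
  tangent := h.tangent

/-- Inverse function theorem for `z ↦ (G z - G y, π z)`, with `π` a projection onto the kernel of
the derivative, identified with `F` by dimension. The chart is then shrunk until the germ-level
hypotheses hold on its whole domain. -/
theorem exists_flattening [FiniteDimensional ℂ E] [FiniteDimensional ℂ K] [FiniteDimensional ℂ F]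
    {S : Set E} {D : Submodule ℂ E} {y : E} (G : E → K) (hG : ContDiffAt ℂ ω G y)
    (hsurj : Function.Surjective (fderiv ℂ G y)) (hD : ∀ v, fderiv ℂ G y v = 0 ↔ v ∈ D)
    (hdim : Module.finrank ℂ K + Module.finrank ℂ F = Module.finrank ℂ E)
    (hS : ∀ᶠ z in 𝓝 y, z ∈ S ↔ G z = G y) :
    ∃ φ : OpenPartialHomeomorph E (K × F), Flattening S D y φ := by
  have : CompleteSpace E := FiniteDimensional.complete ℂ E
  obtain ⟨W, hW⟩ := (LinearMap.ker (fderiv ℂ G y).toLinearMap).exists_isCompl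
  have hker : Module.finrank ℂ (LinearMap.ker (fderiv ℂ G y).toLinearMap)
      = Module.finrank ℂ F := by
    have h1 := (fderiv ℂ G y).toLinearMap.finrank_range_add_finrank_ker
    rw [LinearMap.range_eq_top.2 hsurj, finrank_top] at h1
    omega
  let e : LinearMap.ker (fderiv ℂ G y).toLinearMap ≃ₗ[ℂ] F := LinearEquiv.ofFinrankEq _ _ hker
  let π : E →ₗ[ℂ] F := e.toLinearMap ∘ₗ Submodule.projectionOnto _ _ hW
  let L : E →ₗ[ℂ] K × F := (fderiv ℂ G y).toLinearMap.prod π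
  have hinj : Function.Injective L := by
    rw [← LinearMap.ker_eq_bot, LinearMap.ker_eq_bot']
    intro v hv
    have h1 : fderiv ℂ G y v = 0 := congrArg Prod.fst hv
    have h2 : e (Submodule.projectionOnto _ _ hW v) = 0 := congrArg Prod.snd hv
    have h3 : (⟨v, h1⟩ : LinearMap.ker (fderiv ℂ G y).toLinearMap) = 0 := by
      rw [← Submodule.projectionOnto_apply_left hW ⟨v, h1⟩]
      simpa using h2
    exact congrArg Subtype.val h3
  let Le : E ≃ₗ[ℂ] K × F := LinearEquiv.ofInjectiveOfFinrankEq L hinj (by simp [hdim])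
  let Lc : E ≃L[ℂ] K × F := Le.toContinuousLinearEquiv
  let Φ : E → K × F := fun z => (G z - G y, π z)
  have hπ : ContDiff ℂ ω (fun z => π z) := (LinearMap.toContinuousLinearMap π).contDiff
  have hΦ : ContDiffAt ℂ ω Φ y := (hG.sub contDiffAt_const).prodMk hπ.contDiffAt
  have hGd : DifferentiableAt ℂ G y := hG.differentiableAt (by simp)
  have hd : HasFDerivAt Φ (Lc : E →L[ℂ] K × F) y := by
    have h1 := (hGd.hasFDerivAt.sub_const (G y)).prodMk
      (LinearMap.toContinuousLinearMap π).hasFDerivAt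
    refine h1.congr_fderiv ?_
    ext v <;> rfl
  let φ := hΦ.toOpenPartialHomeomorph Φ hd (by simp)
  have hφ : ∀ z, φ z = Φ z := fun z => rfl
  have hy : y ∈ φ.source := hΦ.mem_toOpenPartialHomeomorph_source hd (by simp)
  have hsymm : ContDiffAt ℂ ω φ.symm (φ y) := hΦ.to_localInverse hd (by simp)
  have e1 : ∀ᶠ z in 𝓝 y, ContDiffAt ℂ ω Φ z := hΦ.eventually (by simp)
  have e2 : ∀ᶠ z in 𝓝 y, ContDiffAt ℂ ω φ.symm (φ z) :=
    (φ.continuousAt hy).eventually (hsymm.eventually (by simp))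
  obtain ⟨U, hU, hUo, hyU⟩ := eventually_nhds_iff.1 (e1.and (e2.and hS))
  refine ⟨φ.restrOpen U hUo, ⟨hy, hyU⟩, ?_, ?_, ?_, ?_⟩
  · intro z hz
    exact (hU z hz.2).1.contDiffWithinAt
  · intro w hw
    have h1 := (φ.restrOpen U hUo).map_target hw
    have h2 := (hU _ h1.2).2.1
    have h3 : φ (φ.symm w) = w := φ.right_inv (by simpa using hw.1)
    rw [show (φ.restrOpen U hUo).symm w = φ.symm w from rfl, h3] at h2
    exact h2.contDiffWithinAt
  · intro z hz
    rw [(hU z hz.2).2.2]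
    exact sub_eq_zero.symm
  · intro v
    rw [← hD]
    have : fderiv ℂ (φ.restrOpen U hUo) y = (Lc : E →L[ℂ] K × F) := hd.fderiv
    rw [this]
    rfl

/-- The slice of a small ball is convex, so its preimage is a connected part of `S` through `y`.
Near `y` the set and its component therefore coincide. -/
theorem Flattening.connectedComponentIn {S : Set E} {D : Submodule ℂ E} {y p : E}
    {φ : OpenPartialHomeomorph E (K × F)} (h : Flattening S D y φ)
    (hy : y ∈ connectedComponentIn S p) :
    ∃ φ' : OpenPartialHomeomorph E (K × F),
      Flattening (_root_.connectedComponentIn S p) D y φ' := by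
  have hyS : y ∈ S := connectedComponentIn_subset _ _ hy
  have ht : φ.target ∈ 𝓝 (φ y) := φ.open_target.mem_nhds (φ.map_source h.mem)
  obtain ⟨ε, hε, hball⟩ := Metric.mem_nhds_iff.1 ht
  have hUo : IsOpen (φ.source ∩ φ ⁻¹' Metric.ball (φ y) ε) :=
    φ.isOpen_inter_preimage Metric.isOpen_ball
  have h' := h.restr hUo ⟨h.mem, Metric.mem_ball_self hε⟩
  refine ⟨_, h'.mem, h'.smooth, h'.smooth_symm, ?_, h'.tangent⟩
  intro z hz
  refine ⟨fun hzS => (h'.mem_iff z hz).1 (connectedComponentIn_subset _ _ hzS), fun hz0 => ?_⟩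
  have hzS : z ∈ S := (h'.mem_iff z hz).2 hz0
  let V : Set (K × F) := Metric.ball (φ y) ε ∩ {w | w.1 = 0}
  have hV : Convex ℝ V := by
    refine (convex_ball _ _).inter ?_
    intro a ha b hb s t _ _ _
    have ha' : a.1 = 0 := ha
    have hb' : b.1 = 0 := hb
    simp [ha', hb']
  have hsub : φ.symm '' V ⊆ S := by
    rintro _ ⟨w, hw, rfl⟩
    refine (h.mem_iff _ (φ.map_target (hball hw.1))).2 ?_
    rw [φ.right_inv (hball hw.1)]
    exact hw.2
  have hconn : IsPreconnected (φ.symm '' V) :=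
    hV.isPreconnected.image _ (φ.continuousOn_symm.mono fun w hw => hball hw.1)
  have hyV : y ∈ φ.symm '' V :=
    ⟨φ y, ⟨Metric.mem_ball_self hε, (h.mem_iff y h.mem).1 hyS⟩, φ.left_inv h.mem⟩
  have hzV : z ∈ φ.symm '' V := ⟨φ z, ⟨hz.2.2, hz0⟩, φ.left_inv hz.1⟩
  rw [connectedComponentIn_eq hy]
  exact hconn.subset_connectedComponentIn hyV hsub hzV

open Classical in
/-- The chart of `S` given by the second component of a flattening coordinate system. -/
def Flattening.chart {S : Set E} {D : Submodule ℂ E} {y : E}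
    {φ : OpenPartialHomeomorph E (K × F)} (h : Flattening S D y φ) (hy : y ∈ S) :
    OpenPartialHomeomorph S F where
  toFun z := (φ z).2
  -- The second branch only makes the map total: on the target the first component is zero, so the
  -- point is in `S`.
  invFun w := if hw : φ.symm (0, w) ∈ S then ⟨φ.symm (0, w), hw⟩ else ⟨y, hy⟩
  source := {z | (z : E) ∈ φ.source}
  target := {w | (0, w) ∈ φ.target}
  map_source' z hz := by
    have h0 := (h.mem_iff z hz).1 z.2
    have : ((0 : K), (φ z).2) = φ z := by rw [← h0]
    simp only [mem_ofPred_eq]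
    rw [this]
    exact φ.map_source hz
  map_target' w hw := by
    have hS : φ.symm (0, w) ∈ S :=
      (h.mem_iff _ (φ.map_target hw)).2 (by rw [φ.right_inv hw])
    simp only [dif_pos hS]
    exact φ.map_target hw
  left_inv' z hz := by
    have h0 := (h.mem_iff z hz).1 z.2
    have : ((0 : K), (φ z).2) = φ z := by rw [← h0]
    ext
    simp only [this, φ.left_inv hz, Subtype.coe_prop, dif_pos]
  right_inv' w hw := by
    have hS : φ.symm (0, w) ∈ S :=
      (h.mem_iff _ (φ.map_target hw)).2 (by rw [φ.right_inv hw])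
    simp only [dif_pos hS, φ.right_inv hw]
  open_source := φ.open_source.preimage continuous_subtype_val
  open_target := φ.open_target.preimage (by fun_prop)
  continuousOn_toFun := (continuous_snd.comp_continuousOn φ.continuousOn).comp
    continuous_subtype_val.continuousOn fun _ hz => hz
  continuousOn_invFun := by
    rw [Topology.IsInducing.subtypeVal.continuousOn_iff]
    refine (φ.continuousOn_symm.comp (f := fun w : F => ((0 : K), w)) (by fun_prop)
      fun _ hw => hw).congr ?_
    intro w hw
    have hS : φ.symm (0, w) ∈ S :=
      (h.mem_iff _ (φ.map_target hw)).2 (by rw [φ.right_inv hw])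
    simp [dif_pos hS]

theorem Flattening.coe_chart_symm {S : Set E} {D : Submodule ℂ E} {y : E}
    {φ : OpenPartialHomeomorph E (K × F)} (h : Flattening S D y φ) (hy : y ∈ S) {w : F}
    (hw : w ∈ (h.chart hy).target) : ((h.chart hy).symm w : E) = φ.symm (0, w) := by
  have hS : φ.symm (0, w) ∈ S :=
    (h.mem_iff _ (φ.map_target hw)).2 (by rw [φ.right_inv hw])
  exact congrArg Subtype.val (dif_pos hS)

end Flattening

end QPlane
end

/-! ### The complex manifold structure on a flattened set -/

noncomputable section
namespace QPlane
open Filter Topology Set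

section leaf

variable {N r : ℕ} {K : Type*} [NormedAddCommGroup K] [NormedSpace ℂ K] {S : Set (Phase N)}
  {φ : Phase N → OpenPartialHomeomorph (Phase N) (K × (Fin r → ℂ))}

/-- The charted space structure on a set that can be flattened around each of its points. -/
abbrev flatChartedSpace (hφ : ∀ y ∈ S, Flattening S (hamiltonianDistribution y) y (φ y)) :
    ChartedSpace (Fin r → ℂ) S where
  atlas := range fun y : S => (hφ y y.2).chart y.2
  chartAt y := (hφ y y.2).chart y.2
  mem_chart_source y := (hφ y y.2).mem
  chart_mem_atlas y := ⟨y, rfl⟩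

/-- Transition maps are ambient coordinate changes restricted to the slice `{0} × F` and projected
to `F`. -/
theorem flat_isManifold (hφ : ∀ y ∈ S, Flattening S (hamiltonianDistribution y) y (φ y)) :
    letI := flatChartedSpace hφ
    IsManifold 𝓘(ℂ, Fin r → ℂ) ω S := by
  let := flatChartedSpace hφ
  apply isManifold_of_contDiffOn
  rintro _ _ ⟨y, rfl⟩ ⟨y', rfl⟩
  have h := hφ y y.2
  have h' := hφ y' y'.2
  have h1 : ContDiffOn ℂ ω (fun w : Fin r → ℂ => (φ y' ((φ y).symm ((0 : K), w))).2)
      ((h.chart y.2).symm ≫ₕ (h'.chart y'.2)).source := by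
    refine contDiff_snd.comp_contDiffOn (h'.smooth.comp (h.smooth_symm.comp
      (contDiff_const.prodMk contDiff_id).contDiffOn fun w hw => hw.1) ?_)
    intro w hw
    have h3 : ((h.chart y.2).symm w : Phase N) ∈ (φ y').source := hw.2
    rw [h.coe_chart_symm y.2 hw.1] at h3
    exact h3
  simp only [modelWithCornersSelf_coe, modelWithCornersSelf_coe_symm, Function.id_comp,
    Function.comp_id, range_id, inter_univ, preimage_id]
  refine h1.congr ?_
  intro w hw
  exact congrArg (fun v => (φ y' v).2) (h.coe_chart_symm y.2 hw.1)

theorem flat_val_comp_symm (hφ : ∀ y ∈ S, Flattening S (hamiltonianDistribution y) y (φ y))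
    (y : S) : Subtype.val ∘ ((hφ y y.2).chart y.2).symm =ᶠ[𝓝 ((hφ y y.2).chart y.2 y)]
      fun w => (φ y).symm ((0 : K), w) := by
  have h := hφ y y.2
  filter_upwards [(h.chart y.2).open_target.mem_nhds ((h.chart y.2).map_source h.mem)] with w hw
  exact h.coe_chart_symm y.2 hw

theorem flat_contMDiff (hφ : ∀ y ∈ S, Flattening S (hamiltonianDistribution y) y (φ y)) :
    letI := flatChartedSpace hφ
    ContMDiff 𝓘(ℂ, Fin r → ℂ) 𝓘(ℂ, Phase N) ω (Subtype.val : S → Phase N) := by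
  let := flatChartedSpace hφ
  intro y
  have h := hφ y y.2
  rw [contMDiffAt_iff]
  refine ⟨continuous_subtype_val.continuousAt, ?_⟩
  have h1 : ContDiffAt ℂ ω (fun w : Fin r → ℂ => (φ y).symm ((0 : K), w)) (h.chart y.2 y) := by
    have hm : ((0 : K), h.chart y.2 y) ∈ (φ y).target := (h.chart y.2).map_source h.mem
    exact (h.smooth_symm.contDiffAt ((φ y).open_target.mem_nhds hm)).comp _
      (contDiff_const.prodMk contDiff_id).contDiffAt
  have h2 := h1.congr_of_eventuallyEq (flat_val_comp_symm hφ y)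
  exact h2.contDiffWithinAt

theorem flat_mfderiv (hφ : ∀ y ∈ S, Flattening S (hamiltonianDistribution y) y (φ y)) (y : S) :
    letI := flatChartedSpace hφ
    (mfderiv 𝓘(ℂ, Fin r → ℂ) 𝓘(ℂ, Phase N) (Subtype.val : S → Phase N) y :
      (Fin r → ℂ) →L[ℂ] Phase N) =
      fderiv ℂ (fun w => (φ y).symm ((0 : K), w)) ((hφ y y.2).chart y.2 y) := by
  let := flatChartedSpace hφ
  have hd := (flat_contMDiff hφ y).mdifferentiableAt (by simp)
  have h1 := hd.hasMFDerivAt.2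
  simp only [modelWithCornersSelf_coe, range_id] at h1
  let L : (Fin r → ℂ) →L[ℂ] Phase N :=
    mfderiv 𝓘(ℂ, Fin r → ℂ) 𝓘(ℂ, Phase N) (Subtype.val : S → Phase N) y
  have h2 : HasFDerivWithinAt (Subtype.val ∘ ((hφ y y.2).chart y.2).symm) L univ
      ((hφ y y.2).chart y.2 y) := h1
  exact ((flat_val_comp_symm hφ y).fderiv_eq.symm.trans
    (h2.hasFDerivAt univ_mem).fderiv).symm

/-- Chain rule on `φ (φ⁻¹ (0, w)) = (0, w)`. The second component gives injectivity of the
differential of the inclusion, the first its tangency to the distribution. -/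
theorem flat_fderiv_symm (hφ : ∀ y ∈ S, Flattening S (hamiltonianDistribution y) y (φ y))
    (y : S) (w : Fin r → ℂ) :
    fderiv ℂ (φ y) y (fderiv ℂ (fun w => (φ y).symm ((0 : K), w)) ((hφ y y.2).chart y.2 y) w)
      = (0, w) := by
  have h := hφ y y.2
  have hm : ((0 : K), h.chart y.2 y) ∈ (φ y).target := (h.chart y.2).map_source h.mem
  have hy : (φ y).symm (0, h.chart y.2 y) = y := by
    have h0 := (h.mem_iff y h.mem).1 y.2
    have : ((0 : K), h.chart y.2 y) = φ y y := Prod.ext h0.symm rfl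
    rw [this, (φ y).left_inv h.mem]
  have d1 : DifferentiableAt ℂ (φ y) ((φ y).symm (0, h.chart y.2 y)) := by
    rw [hy]
    exact (h.smooth.contDiffAt ((φ y).open_source.mem_nhds h.mem)).differentiableAt (by simp)
  have d2 : DifferentiableAt ℂ (fun w : Fin r → ℂ => (φ y).symm ((0 : K), w)) (h.chart y.2 y) := by
    refine ((h.smooth_symm.contDiffAt ((φ y).open_target.mem_nhds hm)).comp _
      (contDiff_const.prodMk contDiff_id).contDiffAt).differentiableAt (by simp)
  have hc := fderiv_comp (f := fun w : Fin r → ℂ => (φ y).symm ((0 : K), w)) (h.chart y.2 y) d1 d2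
  have he : (φ y ∘ fun w : Fin r → ℂ => (φ y).symm ((0 : K), w)) =ᶠ[𝓝 (h.chart y.2 y)]
      fun w => ((0 : K), w) := by
    filter_upwards [(h.chart y.2).open_target.mem_nhds ((h.chart y.2).map_source h.mem)] with w hw
    exact (φ y).right_inv hw
  rw [he.fderiv_eq, hy] at hc
  have hd : HasFDerivAt (fun w : Fin r → ℂ => ((0 : K), w))
      (ContinuousLinearMap.inr ℂ K (Fin r → ℂ)) (h.chart y.2 y) :=
    (ContinuousLinearMap.inr ℂ K (Fin r → ℂ)).hasFDerivAt
  rw [hd.fderiv] at hc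
  have := congrArg (fun f => f w) hc
  simpa using this.symm

/-- A connected set that can be flattened around each of its points is an integral manifold. -/
def flatIntegralManifold (hφ : ∀ y ∈ S, Flattening S (hamiltonianDistribution y) y (φ y))
    (hr : ∀ y ∈ S, Module.finrank ℂ (hamiltonianDistribution y) = r)
    (hS : IsConnected S) : IntegralManifold N :=
  letI := flatChartedSpace hφ
  have hmem : ∀ (p : S) w, mfderiv 𝓘(ℂ, Fin r → ℂ) 𝓘(ℂ, Phase N) (Subtype.val : S → Phase N) p w
      ∈ hamiltonianDistribution (p : Phase N) := fun p w => by
    have h1 := flat_fderiv_symm hφ p w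
    rw [← flat_mfderiv hφ p] at h1
    exact ((hφ p p.2).tangent _).1 (congrArg Prod.fst h1)
  have hinj : ∀ p : S, Function.Injective
      (mfderiv 𝓘(ℂ, Fin r → ℂ) 𝓘(ℂ, Phase N) (Subtype.val : S → Phase N) p) := fun p w w' hw => by
    have h1 := flat_fderiv_symm hφ p w
    have h2 := flat_fderiv_symm hφ p w'
    rw [← flat_mfderiv hφ p] at h1 h2
    have h3 := h1.symm.trans ((congrArg (fderiv ℂ (φ p) p) hw).trans h2)
    exact congrArg Prod.snd h3
  { dim := r
    M := S
    charted := flatChartedSpace hφ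
    manifold := flat_isManifold hφ
    connected := isConnected_iff_connectedSpace.1 hS
    incl := Subtype.val
    incl_injective := Subtype.val_injective
    incl_holomorphic := flat_contMDiff hφ
    incl_immersion := hinj
    tangent_eq := fun p v => by
      refine ⟨?_, fun hv => ?_⟩
      · rintro ⟨w, rfl⟩
        exact hmem p w
      · let f : (Fin r → ℂ) →ₗ[ℂ] hamiltonianDistribution (p : Phase N) :=
          LinearMap.codRestrict _
            (mfderiv 𝓘(ℂ, Fin r → ℂ) 𝓘(ℂ, Phase N) (Subtype.val : S → Phase N) p).toLinearMap
            (hmem p)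
        have hf : Function.Injective f := fun w w' hw => hinj p (congrArg Subtype.val hw)
        have hs := (LinearMap.injective_iff_surjective_of_finrank_eq_finrank
          (by rw [hr p p.2]; simp)).1 hf
        obtain ⟨w, hw⟩ := hs ⟨v, hv⟩
        exact ⟨w, congrArg Subtype.val hw⟩ }

theorem flatIntegralManifold_points
    (hφ : ∀ y ∈ S, Flattening S (hamiltonianDistribution y) y (φ y))
    (hr : ∀ y ∈ S, Module.finrank ℂ (hamiltonianDistribution y) = r) (hS : IsConnected S) :
    (flatIntegralManifold hφ hr hS).points = S :=
  Subtype.range_coe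

end leaf

end QPlane
end

/-! ### Persistence of zeros along immersions, and integral manifolds -/

noncomputable section
namespace QPlane
open Filter Topology Set

section flow

variable {E U F : Type*} [NormedAddCommGroup E] [NormedSpace ℂ E]
  [NormedAddCommGroup U] [NormedSpace ℂ U]
  [NormedAddCommGroup F] [NormedSpace ℂ F]

/-- Grönwall's inequality along each segment starting at `w₀`. -/
theorem eventually_eq_zero_of_norm_fderiv_le {f : F → ℂ} {w₀ : F} {C : ℝ}
    (hd : ∀ᶠ w in 𝓝 w₀, DifferentiableAt ℂ f w) (hC : ∀ᶠ w in 𝓝 w₀, ‖fderiv ℂ f w‖ ≤ C * ‖f w‖)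
    (h0 : f w₀ = 0) : ∀ᶠ w in 𝓝 w₀, f w = 0 := by
  obtain ⟨ε, hε, hball⟩ := Metric.eventually_nhds_iff_ball.1 (hd.and hC)
  refine Metric.eventually_nhds_iff_ball.2 ⟨ε, hε, fun w hw => ?_⟩
  have hmem : ∀ t ∈ Icc (0 : ℝ) 1, w₀ + t • (w - w₀) ∈ Metric.ball w₀ ε := by
    intro t ht
    rw [mem_ball_iff_norm] at hw ⊢
    rw [add_sub_cancel_left, norm_smul, Real.norm_eq_abs, abs_of_nonneg ht.1]
    nlinarith [norm_nonneg (w - w₀), ht.2]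
  have hder : ∀ t ∈ Icc (0 : ℝ) 1, HasDerivAt (fun t : ℝ => f (w₀ + t • (w - w₀)))
      (fderiv ℂ f (w₀ + t • (w - w₀)) (w - w₀)) t := by
    intro t ht
    have h1 := ((hball _ (hmem t ht)).1.hasFDerivAt.restrictScalars ℝ)
    have h2 : HasDerivAt (fun t : ℝ => w₀ + t • (w - w₀)) (w - w₀) t := by
      simpa using ((hasDerivAt_id t).smul_const (w - w₀)).const_add w₀
    exact h1.comp_hasDerivAt t h2
  have := eq_zero_of_abs_deriv_le_mul_abs_self_of_eq_zero_right
    (f := fun t : ℝ => f (w₀ + t • (w - w₀))) (K := C * ‖w - w₀‖) (a := 0) (b := 1)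
    (fun t ht => (hder t ht).continuousAt.continuousWithinAt)
    (fun t ht => (hder t (Ico_subset_Icc_self ht)).hasDerivWithinAt) (by simpa using h0)
    (fun t ht => by
      refine (ContinuousLinearMap.le_opNorm _ _).trans ?_
      have := (hball _ (hmem t (Ico_subset_Icc_self ht))).2
      nlinarith [norm_nonneg (w - w₀)]) 1 (by simp)
  simpa using this

theorem eventually_eq_of_fderiv_eq_zero {G : Type*} [NormedAddCommGroup G] [NormedSpace ℂ G]
    {f : F → G} {w₀ : F} (hd : ∀ᶠ w in 𝓝 w₀, DifferentiableAt ℂ f w)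
    (h : ∀ᶠ w in 𝓝 w₀, fderiv ℂ f w = 0) : ∀ᶠ w in 𝓝 w₀, f w = f w₀ := by
  obtain ⟨ε, hε, hball⟩ := Metric.eventually_nhds_iff_ball.1 (hd.and h)
  refine Metric.eventually_nhds_iff_ball.2 ⟨ε, hε, fun w hw => ?_⟩
  exact Metric.isOpen_ball.is_const_of_fderiv_eq_zero
    (convex_ball w₀ ε).isPreconnected (fun z hz => (hball z hz).1.differentiableWithinAt)
    (fun z hz => (hball z hz).2) hw (Metric.mem_ball_self hε)

variable [FiniteDimensional ℂ E] [FiniteDimensional ℂ F]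

/-- If the image of an immersion `ι` is tangent to the distribution spanned by the columns of `B`,
tangent vectors lift continuously through `B`. -/
theorem exists_lift_of_range_eq {ι : F → E} {w₀ : F} {O : Set F} (hO : IsOpen O) (hw₀ : w₀ ∈ O)
    (hι : ContDiffOn ℂ ω ι O) {B : E → U →L[ℂ] E} (hB : Continuous B)
    (hinj : ∀ w ∈ O, Function.Injective (fderiv ℂ ι w))
    (hrange : ∀ w ∈ O, ∀ v, (∃ e, fderiv ℂ ι w e = v) ↔ ∃ c, B (ι w) c = v) :
    ∃ C : F → F →L[ℂ] U, ContinuousAt C w₀ ∧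
      ∀ᶠ w in 𝓝 w₀, ∀ e, B (ι w) (C w e) = fderiv ℂ ι w e := by
  have : CompleteSpace F := FiniteDimensional.complete ℂ F
  have hA : ContinuousAt (fderiv ℂ ι) w₀ :=
    (hι.continuousOn_fderiv_of_isOpen hO (by simp)).continuousAt (hO.mem_nhds hw₀)
  have hBι : ContinuousAt (fun w => B (ι w)) w₀ :=
    hB.continuousAt.comp (hι.continuousOn.continuousAt (hO.mem_nhds hw₀))
  obtain ⟨π', hπ'⟩ := (fderiv ℂ ι w₀).toLinearMap.exists_leftInverse_of_injective
    (LinearMap.ker_eq_bot.2 (hinj w₀ hw₀))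
  let π : E →L[ℂ] F := LinearMap.toContinuousLinearMap π'
  have hπ : ∀ e, π (fderiv ℂ ι w₀ e) = e := fun e => congrArg (fun f => f e) hπ'
  have hsurj : Function.Surjective (π.comp (B (ι w₀))) := by
    intro e
    obtain ⟨c, hc⟩ := (hrange w₀ hw₀ _).1 ⟨e, rfl⟩
    exact ⟨c, by simp [hc, hπ]⟩
  obtain ⟨R, hR⟩ := ContinuousLinearMap.exists_rightInverse_of_surjective _
    (LinearMap.range_eq_top.2 hsurj)
  -- `T` and `A` compress `B ∘ ι` and the derivative of `ι` to endomorphisms of `F`. Both are the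
  -- identity at `w₀`, hence invertible nearby, and `R T⁻¹ A` is the lift.
  let T : F → F →L[ℂ] F := fun w => (π.comp (B (ι w))).comp R
  let A : F → F →L[ℂ] F := fun w => π.comp (fderiv ℂ ι w)
  have hT : ContinuousAt T w₀ :=
    (continuousAt_const.clm_comp hBι).clm_comp continuousAt_const
  have hAc : ContinuousAt A w₀ := continuousAt_const.clm_comp hA
  have hT0 : T w₀ = 1 := hR
  have hA0 : A w₀ = 1 := by ext1 e; exact hπ e
  have hTu : ∀ᶠ w in 𝓝 w₀, IsUnit (T w) :=
    hT.eventually (Units.isOpen.mem_nhds (by rw [hT0]; exact isUnit_one))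
  have hAu : ∀ᶠ w in 𝓝 w₀, IsUnit (A w) :=
    hAc.eventually (Units.isOpen.mem_nhds (by rw [hA0]; exact isUnit_one))
  have hinv : ContinuousAt (fun w => Ring.inverse (T w)) w₀ := by
    have h1 := NormedRing.inverse_continuousAt (1 : (F →L[ℂ] F)ˣ)
    rw [Units.val_one, ← hT0] at h1
    exact ContinuousAt.comp (f := T) h1 hT
  refine ⟨fun w => R.comp ((Ring.inverse (T w)).comp (A w)),
    continuousAt_const.clm_comp (hinv.clm_comp hAc), ?_⟩
  filter_upwards [hTu, hAu, hO.mem_nhds hw₀] with w hTw hAw hwO e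
  -- The lifted vector is tangent, hence the image of some `e'`. Applying `π` gives `A e' = A e`,
  -- and `A` is invertible.
  obtain ⟨e', he'⟩ := (hrange w hwO _).2 ⟨R (Ring.inverse (T w) (A w e)), rfl⟩
  have h1 : A w e' = A w e := by
    change π (fderiv ℂ ι w e') = A w e
    rw [he']
    change (T w * Ring.inverse (T w) : F →L[ℂ] F) (A w e) = A w e
    rw [Ring.mul_inverse_cancel _ hTw]
    rfl
  have h2 : e' = e := by
    have h3 := congrArg (Ring.inverse (A w) : F →L[ℂ] F) h1
    change (Ring.inverse (A w) * A w : F →L[ℂ] F) e' = (Ring.inverse (A w) * A w : F →L[ℂ] F) e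
      at h3
    rwa [Ring.inverse_mul_cancel _ hAw] at h3
  rw [h2] at he'
  exact he'.symm

/-- With the continuous lift `C`, the derivative of `h ∘ ι` is `h ∘ ι` times the locally bounded
form `β ∘ C`, so Grönwall applies. -/
theorem eventually_eq_zero_of_fderiv_eq_mul {ι : F → E} {w₀ : F} {O : Set F} (hO : IsOpen O)
    (hw₀ : w₀ ∈ O) (hι : ContDiffOn ℂ ω ι O) {B : E → U →L[ℂ] E} (hB : Continuous B)
    (hinj : ∀ w ∈ O, Function.Injective (fderiv ℂ ι w))
    (hrange : ∀ w ∈ O, ∀ v, (∃ e, fderiv ℂ ι w e = v) ↔ ∃ c, B (ι w) c = v)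
    {h : E → ℂ} (hh : Differentiable ℂ h) {β : E → U →L[ℂ] ℂ} (hβ : Continuous β)
    (hrel : ∀ᶠ w in 𝓝 w₀, ∀ c, fderiv ℂ h (ι w) (B (ι w) c) = h (ι w) * β (ι w) c)
    (h0 : h (ι w₀) = 0) : ∀ᶠ w in 𝓝 w₀, h (ι w) = 0 := by
  obtain ⟨C, hC, hBC⟩ := exists_lift_of_range_eq hO hw₀ hι hB hinj hrange
  have hιd : ∀ w ∈ O, DifferentiableAt ℂ ι w := fun w hw =>
    (hι.contDiffAt (hO.mem_nhds hw)).differentiableAt (by simp)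
  have hγ : ContinuousAt (fun w => (β (ι w)).comp (C w)) w₀ :=
    (hβ.continuousAt.comp (hιd w₀ hw₀).continuousAt).clm_comp hC
  have hbd : ∀ᶠ w in 𝓝 w₀, ‖(β (ι w)).comp (C w)‖ < ‖(β (ι w₀)).comp (C w₀)‖ + 1 :=
    hγ.norm.eventually_lt_const (by simp)
  refine eventually_eq_zero_of_norm_fderiv_le (f := fun w => h (ι w))
    (C := ‖(β (ι w₀)).comp (C w₀)‖ + 1) ?_ ?_ h0
  · filter_upwards [hO.mem_nhds hw₀] with w hw
    exact (hh _).comp w (hιd w hw)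
  · filter_upwards [hO.mem_nhds hw₀, hbd, hBC, hrel] with w hw h1 h2 h3
    have h4 : fderiv ℂ (fun w => h (ι w)) w = h (ι w) • ((β (ι w)).comp (C w)) := by
      have := fderiv_comp w (hh (ι w)) (hιd w hw)
      change fderiv ℂ (h ∘ ι) w = _
      rw [this]
      ext e
      simp [← h2 e, h3]
    rw [h4, norm_smul, mul_comm]
    gcongr

end flow

section manifold

attribute [local instance] IntegralManifold.top IntegralManifold.charted IntegralManifold.manifold
  IntegralManifold.connected

/-- The differential of the inclusion is injective with image the fibre of the distribution, which
reduces the dimension formulas to a rank computation at one point. -/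
theorem IntegralManifold.dim_eq {N : ℕ} (L : IntegralManifold N) (p : L.M) :
    L.dim = Module.finrank ℂ (hamiltonianDistribution (L.incl p)) := by
  let A : (Fin L.dim → ℂ) →L[ℂ] Phase N := mfderiv 𝓘(ℂ, Fin L.dim → ℂ) 𝓘(ℂ, Phase N) L.incl p
  have hA : Function.Injective A.toLinearMap := L.incl_immersion p
  have h1 : LinearMap.range A.toLinearMap = hamiltonianDistribution (L.incl p) := by
    ext v
    exact L.tangent_eq p v
  rw [← h1, LinearMap.finrank_range_of_inj hA]
  simp

/-- The inverse of a chart turns local questions on the manifold into calculus on an open set of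
`ℂ^d`; the last clause carries germ statements back. -/
theorem IntegralManifold.exists_parametrization {N : ℕ} (L : IntegralManifold N) (q : L.M) :
    ∃ (ι : (Fin L.dim → ℂ) → Phase N) (w₀ : Fin L.dim → ℂ) (O : Set (Fin L.dim → ℂ)),
      IsOpen O ∧ w₀ ∈ O ∧ ContDiffOn ℂ ω ι O ∧ ι w₀ = L.incl q ∧
      (∀ w ∈ O, Function.Injective (fderiv ℂ ι w)) ∧
      (∀ w ∈ O, ∀ v, (∃ e, fderiv ℂ ι w e = v) ↔ v ∈ hamiltonianDistribution (ι w)) ∧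
      ∀ P : Phase N → Prop, (∀ᶠ w in 𝓝 w₀, P (ι w)) → ∀ᶠ q' in 𝓝 q, P (L.incl q') := by
  let e := chartAt (Fin L.dim → ℂ) q
  have hq : q ∈ e.source := mem_chart_source _ q
  have hsm : ContMDiffOn 𝓘(ℂ, Fin L.dim → ℂ) 𝓘(ℂ, Phase N) ω (L.incl ∘ e.symm) e.target :=
    L.incl_holomorphic.comp_contMDiffOn contMDiffOn_chart_symm
  have he : e.MDifferentiable 𝓘(ℂ, Fin L.dim → ℂ) 𝓘(ℂ, Fin L.dim → ℂ) := by
    have : IsManifold 𝓘(ℂ, Fin L.dim → ℂ) 1 L.M := IsManifold.of_le (n := ω) (by simp)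
    exact mdifferentiable_chart q
  have hder : ∀ w ∈ e.target, ∀ v, (fderiv ℂ (L.incl ∘ e.symm) w v : Phase N) =
      mfderiv 𝓘(ℂ, Fin L.dim → ℂ) 𝓘(ℂ, Phase N) L.incl (e.symm w)
        (mfderiv 𝓘(ℂ, Fin L.dim → ℂ) 𝓘(ℂ, Fin L.dim → ℂ) e.symm w v) := by
    intro w hw v
    rw [← mfderiv_eq_fderiv]
    have h1 := mfderiv_comp w ((L.incl_holomorphic (e.symm w)).mdifferentiableAt (by simp))
      (he.mdifferentiableAt_symm hw)
    rw [h1]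
    rfl
  refine ⟨L.incl ∘ e.symm, e q, e.target, e.open_target, e.map_source hq, ?_, ?_, ?_, ?_, ?_⟩
  · exact contMDiffOn_iff_contDiffOn.1 hsm
  · exact congrArg L.incl (e.left_inv hq)
  · intro w hw v v' hv
    rw [hder w hw, hder w hw] at hv
    exact he.symm.mfderiv_injective hw (L.incl_immersion _ hv)
  · intro w hw v
    refine Iff.trans ?_ (L.tangent_eq (e.symm w) v)
    constructor
    · rintro ⟨u, rfl⟩
      exact ⟨_, (hder w hw u).symm⟩
    · rintro ⟨u, rfl⟩
      obtain ⟨u', rfl⟩ := he.symm.mfderiv_surjective hw u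
      exact ⟨u', hder w hw u'⟩
  · intro P hP
    filter_upwards [(e.continuousAt hq).eventually hP, e.open_source.mem_nhds hq] with q' h1 h2
    simpa [e.left_inv h2] using h1

theorem IntegralManifold.continuous_incl {N : ℕ} (L : IntegralManifold N) :
    Continuous L.incl := L.incl_holomorphic.continuous

/-- An equivalence relation on the points of phase space whose classes are locally preserved along
integral manifolds is preserved along them. -/
theorem IntegralManifold.rel_of_locally {N : ℕ} (L : IntegralManifold N)
    (R : Setoid (Phase N)) (h : ∀ q : L.M, ∀ᶠ q' in 𝓝 q, R (L.incl q') (L.incl q)) (p q : L.M) :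
    R (L.incl q) (L.incl p) := by
  have hc : IsClopen {q | R (L.incl q) (L.incl p)} := by
    constructor
    · rw [← isOpen_compl_iff, isOpen_iff_mem_nhds]
      intro q hq
      filter_upwards [h q] with q' hq' h'
      exact hq (R.trans (R.symm hq') h')
    · rw [isOpen_iff_mem_nhds]
      intro q hq
      filter_upwards [h q] with q' hq'
      exact R.trans hq' hq
  have := hc.eq_univ ⟨p, R.refl _⟩
  exact eq_univ_iff_forall.1 this q

/-- The leaf through `p` is the connected component of `p` in its class, provided that the classes
can be flattened and are preserved along integral manifolds. -/
theorem exists_leaf {N r : ℕ} {K : Type*} [NormedAddCommGroup K] [NormedSpace ℂ K]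
    (R : Setoid (Phase N)) (p : Phase N)
    (hR : ∀ (L : IntegralManifold N) (q : L.M), ∀ᶠ q' in 𝓝 q, R (L.incl q') (L.incl q))
    (hflat : ∀ y, R y p → ∃ φ : OpenPartialHomeomorph (Phase N) (K × (Fin r → ℂ)),
      Flattening {y | R y p} (hamiltonianDistribution y) y φ)
    (hr : ∀ y, R y p → Module.finrank ℂ (hamiltonianDistribution y) = r) :
    ∃ L : IntegralManifold N, L.IsSymplecticLeaf ∧ p ∈ L.points := by
  set S : Set (Phase N) := {y | R y p} with hS
  have hp : p ∈ S := R.refl p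
  have hcs : ∀ y ∈ connectedComponentIn S p, R y p := fun y hy =>
    show y ∈ S from connectedComponentIn_subset S p hy
  have hex : ∀ y : Phase N, ∃ φ : OpenPartialHomeomorph (Phase N) (K × (Fin r → ℂ)),
      y ∈ connectedComponentIn S p →
        Flattening (connectedComponentIn S p) (hamiltonianDistribution y) y φ := by
    intro y
    by_cases hy : y ∈ connectedComponentIn S p
    · obtain ⟨φ, hφ⟩ := hflat y (hcs y hy)
      obtain ⟨φ', hφ'⟩ := hφ.connectedComponentIn hy
      exact ⟨φ', fun _ => hφ'⟩
    · obtain ⟨φ, -⟩ := hflat p hp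
      exact ⟨φ, fun h => absurd h hy⟩
  choose φ hφ using hex
  have hpc : p ∈ connectedComponentIn S p := mem_connectedComponentIn hp
  have hconn : IsConnected (connectedComponentIn S p) := isConnected_connectedComponentIn_iff.2 hp
  have hr' := fun y hy => hr y (hcs y hy)
  have hpts := flatIntegralManifold_points hφ hr' hconn
  refine ⟨flatIntegralManifold hφ hr' hconn, ?_, ?_⟩
  · intro L' hL'
    rw [hpts] at hL' ⊢
    refine Subset.antisymm ?_ hL'
    obtain ⟨p', hp'⟩ := hL' hpc
    -- Maximality: a competitor has connected image inside the class of `p`, hence inside the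
    -- component of `p`.
    refine (isPreconnected_range L'.continuous_incl).subset_connectedComponentIn (hL' hpc) ?_
    rintro _ ⟨q, rfl⟩
    have := L'.rel_of_locally R (hR L') p' q
    rw [hp'] at this
    exact this
  · rw [hpts]
    exact hpc

end manifold

end QPlane
end

/-! ### Vanishing patterns and the solution of the kernel equations -/

noncomputable section
namespace QPlane

theorem descending_induction {p : ℕ → Prop} {N : ℕ} (h0 : p N) (hs : ∀ k < N, p (k + 1) → p k)
    (k : ℕ) (hk : k ≤ N) : p k := by
  obtain ⟨n, rfl⟩ := Nat.exists_eq_add_of_le hk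
  clear hk
  induction n generalizing k with
  | zero => exact h0
  | succ n ih =>
    refine hs k (by omega) (ih (k + 1) ?_ ?_)
    · rwa [show k + 1 + n = k + (n + 1) by omega]
    · rwa [show k + 1 + n = k + (n + 1) by omega]

/-- The vanishing pattern of a point: `z k` records whether the partial sum from `k` vanishes, `za`
and `zb` record which coordinates vanish at the indices `j` where `z j` and `z (j + 1)` hold. -/
@[ext] structure Pattern where
  z : ℕ → Prop
  za : ℕ → Prop
  zb : ℕ → Prop

namespace Pattern

variable (P : Pattern) (N : ℕ)

/-- Both adjacent partial sums vanish. -/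
def Flat (j : ℕ) : Prop := P.z j ∧ P.z (j + 1)

/-- Both adjacent partial sums vanish, but not both coordinates do. -/
def Single (j : ℕ) : Prop := P.Flat j ∧ ¬(P.za j ∧ P.zb j)

/-- Auxiliary recursion for `Pattern.Ev`. -/
def evAux : ℕ → Prop
  | 0 => True
  | n + 1 => P.z (N - (n + 1)) ∧
      (P.z (N - (n + 1) + 1) → (P.Single (N - (n + 1)) ↔ ¬ evAux n))

/-- The partial sum from `k` vanishes, and there is an even number of non-zero coordinates between
`k` and the next place above where a partial sum does not vanish. -/
def Ev (k : ℕ) : Prop := P.evAux N (N - k)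

theorem ev_top : P.Ev N N := by simp [Ev, evAux]

theorem ev_iff {k : ℕ} (hk : k < N) :
    P.Ev N k ↔ P.z k ∧ (P.z (k + 1) → (P.Single k ↔ ¬ P.Ev N (k + 1))) := by
  have h1 : N - k = (N - (k + 1)) + 1 := by omega
  have h2 : N - ((N - (k + 1)) + 1) = k := by omega
  rw [Ev, h1, evAux, h2, Ev]

/-- The places which carry a Casimir function. -/
def Act : ℕ → Prop
  | 0 => ¬ P.Ev N 0
  | j + 1 => (P.z (j + 1) ∧ ¬ P.z j ∧ P.Ev N (j + 1)) ∨ (¬ P.z (j + 1) ∧ P.z j)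

open Classical in
/-- The signs of the exponents of the Casimir function which starts at `k₀`. -/
def sgn (k₀ : ℕ) : ℕ → ℤ
  | 0 => if k₀ = 0 then 1 else 0
  | k + 1 => if k₀ = k + 1 then 1 else
      if P.Flat k then (if P.Single k then (if P.za k then sgn k₀ k else -sgn k₀ k)
        else sgn k₀ k) else 0

open Classical in
/-- The part of `sgn` supported at the places with an even state. -/
def lowSgn (k₀ k : ℕ) : ℤ := if P.Ev N k then P.sgn k₀ k else 0

open Classical in
/-- The part of `sgn` supported at the places with an odd state. -/
def highSgn (k₀ k : ℕ) : ℤ := if P.Ev N k then 0 else P.sgn k₀ k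

/-- The exponent of `a_k` in the Casimir function which starts at `k₀`. -/
def expA (k₀ k : ℕ) : ℤ := (P.highSgn N k₀ k - P.highSgn N k₀ (k + 1))
  - (P.lowSgn N k₀ (k + 1) - P.lowSgn N k₀ k)

/-- The exponent of `a_k^*` in the Casimir function which starts at `k₀`. -/
def expB (k₀ k : ℕ) : ℤ := (P.highSgn N k₀ k - P.highSgn N k₀ (k + 1))
  + (P.lowSgn N k₀ (k + 1) - P.lowSgn N k₀ k)

theorem sgn_self (k₀ : ℕ) : P.sgn k₀ k₀ = 1 := by
  cases k₀ <;> simp [sgn]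

theorem sgn_of_lt {k₀ k : ℕ} (h : k < k₀) : P.sgn k₀ k = 0 := by
  induction k with
  | zero => simp [sgn, h.ne']
  | succ k ih => simp [sgn, h.ne', ih (by omega)]

end Pattern

/-- Sequences `a`, `b` of length `N` with partial sums `O` of their products, which have the
vanishing pattern `P`. -/
structure HasPattern (P : Pattern) (N : ℕ) (a b O : ℕ → ℂ) : Prop where
  sum_top : O N = 0
  sum_step : ∀ k < N, O k = a k * b k + O (k + 1)
  z_iff : ∀ k ≤ N, P.z k ↔ O k = 0
  za_iff : ∀ k < N, P.za k ↔ O k = 0 ∧ O (k + 1) = 0 ∧ a k = 0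
  zb_iff : ∀ k < N, P.zb k ↔ O k = 0 ∧ O (k + 1) = 0 ∧ b k = 0

/-- The covector with components `p`, `q` at a point with coordinates `a`, `b` lies in the kernel of
the Poisson structure; `M` and `H` are the sums of `q b - p a` below, and of `p a + q b` above. -/
structure IsKernel (N : ℕ) (a b O p q M H : ℕ → ℂ) : Prop where
  low_zero : M 0 = 0
  low_step : ∀ k < N, M (k + 1) = M k + (q k * b k - p k * a k)
  high_top : H N = 0
  high_step : ∀ k < N, H k = H (k + 1) + (p k * a k + q k * b k)
  eq_a : ∀ k < N, a k * (M k + H (k + 1)) = 2 * q k * O (k + 1)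
  eq_b : ∀ k < N, b k * (H (k + 1) - M k) = 2 * p k * O (k + 1)

section

variable {P : Pattern} {N : ℕ} {a b O p q M H : ℕ → ℂ}

/-- The right-hand sides vanish and `a_k b_k = 0`. A single non-zero coordinate forces `M_k =
±H_{k+1}` and so exchanges the roles of `M` and `H`; with none, both pass through unchanged. -/
theorem IsKernel.flat_step (hP : HasPattern P N a b O) (hK : IsKernel N a b O p q M H) {k : ℕ}
    (hk : k < N) (h0 : O k = 0) (h1 : O (k + 1) = 0) :
    (P.Single k → P.za k → H k = M (k + 1) ∧ M k = H (k + 1)) ∧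
    (P.Single k → ¬ P.za k → H k = -M (k + 1) ∧ M k = -H (k + 1)) ∧
    (¬ P.Single k → H k = H (k + 1) ∧ M k = M (k + 1)) := by
  have hs := hP.sum_step k hk
  have hl := hK.low_step k hk
  have hh := hK.high_step k hk
  have ha := hK.eq_a k hk
  have hb := hK.eq_b k hk
  have hflat : P.Flat k := ⟨(hP.z_iff k hk.le).2 h0, (hP.z_iff (k + 1) hk).2 h1⟩
  have hza : P.za k ↔ a k = 0 := by rw [hP.za_iff k hk]; tauto
  have hzb : P.zb k ↔ b k = 0 := by rw [hP.zb_iff k hk]; tauto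
  have hab : a k * b k = 0 := by rw [h0, h1] at hs; simpa using hs.symm
  rw [h1] at ha hb
  simp only [mul_zero, mul_eq_zero] at ha hb hab
  rw [Pattern.Single, hza, hzb]
  refine ⟨fun h h2 => ?_, fun h h2 => ?_, fun h => ?_⟩
  · have hb0 : b k ≠ 0 := fun h3 => h.2 ⟨h2, h3⟩
    have h3 := hb.resolve_left hb0
    rw [h2] at hl hh
    exact ⟨by linear_combination hh - hl + h3, by linear_combination -h3⟩
  · have h4 : b k = 0 := hab.resolve_left h2
    have h3 := ha.resolve_left h2
    rw [h4] at hl hh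
    exact ⟨by linear_combination hh + hl + h3, by linear_combination h3⟩
  · have h2 : a k = 0 ∧ b k = 0 := by tauto
    rw [h2.1, h2.2] at hl hh
    exact ⟨by linear_combination hh, by linear_combination -hl⟩

/-- Obtained by eliminating `p_k`, `q_k`. Where the sums do not vanish, `M Ω` and `H / Ω` are
constant. -/
theorem IsKernel.slope_step (hP : HasPattern P N a b O) (hK : IsKernel N a b O p q M H) {k : ℕ}
    (hk : k < N) : M (k + 1) * O (k + 1) = M k * O k ∧ H k * O (k + 1) = H (k + 1) * O k := by
  have hs := hP.sum_step k hk
  have hl := hK.low_step k hk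
  have hh := hK.high_step k hk
  have ha := hK.eq_a k hk
  have hb := hK.eq_b k hk
  constructor
  · linear_combination O (k + 1) * hl - b k / 2 * ha + a k / 2 * hb - M k * hs
  · linear_combination O (k + 1) * hh - b k / 2 * ha - a k / 2 * hb - H (k + 1) * hs

theorem IsKernel.cusp_step (hP : HasPattern P N a b O) (hK : IsKernel N a b O p q M H) {k : ℕ}
    (hk : k < N) (h0 : O k ≠ 0) (h1 : O (k + 1) = 0) : M k = 0 ∧ H (k + 1) = 0 := by
  have hs := hP.sum_step k hk
  have ha := hK.eq_a k hk
  have hb := hK.eq_b k hk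
  rw [h1] at hs ha hb
  have h2 : a k ≠ 0 := fun h => h0 (by rw [hs, h]; ring)
  have h3 : b k ≠ 0 := fun h => h0 (by rw [hs, h]; ring)
  have h4 : M k + H (k + 1) = 0 := by simpa [h2] using ha
  have h5 : H (k + 1) - M k = 0 := by simpa [h3] using hb
  exact ⟨by linear_combination (h4 - h5) / 2, by linear_combination (h4 + h5) / 2⟩

/-- Downward sweep from `H_N = 0`. A cusp (`Ω_k ≠ 0 = Ω_{k+1}`) forces `M_k = 0`, the foot of a
slope (`Ω_k = 0 ≠ Ω_{k+1}`) forces `H_k = 0`, and each single coordinate in a flat run exchanges the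
two cases. These are exactly the transitions of `Ev`. -/
theorem IsKernel.state (hP : HasPattern P N a b O) (hK : IsKernel N a b O p q M H) {k : ℕ}
    (hk : k ≤ N) : (P.Ev N k → H k = 0) ∧ (¬ P.Ev N k → M k = 0) := by
  refine descending_induction (p := fun k => (P.Ev N k → H k = 0) ∧ (¬ P.Ev N k → M k = 0))
    ⟨fun _ => hK.high_top, fun h => absurd (P.ev_top N) h⟩ ?_ k hk
  intro k hk ih
  have hsl := hK.slope_step hP hk
  have hev := P.ev_iff N hk
  rw [hP.z_iff k hk.le, hP.z_iff (k + 1) hk] at hev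
  by_cases h1 : O (k + 1) = 0
  · by_cases h0 : O k = 0
    · have := hK.flat_step hP hk h0 h1
      by_cases hs : P.Single k <;> by_cases hza : P.za k <;> by_cases he : P.Ev N (k + 1) <;>
        simp_all
    · have := hK.cusp_step hP hk h0 h1
      exact ⟨fun h => absurd (hev.1 h).1 h0, fun _ => this.1⟩
  · have hz : ¬ P.Ev N (k + 1) := by
      intro h
      rcases Nat.lt_or_ge (k + 1) N with h2 | h2
      · exact h1 ((hP.z_iff _ h2.le).1 (((P.ev_iff N h2).1 h).1))
      · exact h1 (by rw [show k + 1 = N by omega]; exact hP.sum_top)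
    by_cases h0 : O k = 0
    · refine ⟨fun _ => ?_, fun h => absurd (hev.2 ⟨h0, fun h => absurd h h1⟩) h⟩
      have := hsl.2
      rw [h0, mul_zero] at this
      exact (mul_eq_zero.1 this).resolve_right h1
    · refine ⟨fun h => absurd (hev.1 h).1 h0, fun _ => ?_⟩
      have := hsl.1
      rw [ih.2 hz, zero_mul] at this
      exact (mul_eq_zero.1 this.symm).resolve_right h0

theorem HasPattern.sum_eq_zero_of_ev (hP : HasPattern P N a b O) {k : ℕ} (hk : k ≤ N)
    (h : P.Ev N k) : O k = 0 := by
  rcases Nat.lt_or_ge k N with h2 | h2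
  · exact (hP.z_iff _ h2.le).1 (((P.ev_iff N h2).1 h).1)
  · rw [show k = N by omega]; exact hP.sum_top

/-- Upward sweep from `M_0 = 0`: `state` kills one scalar at each place, and the other comes from
the place below or is killed by the assumption at an active place. With `M = H = 0`, the equations
leave `p_k`, `q_k` undetermined only at the recorded zero coordinates. -/
theorem IsKernel.eq_zero (hP : HasPattern P N a b O) (hK : IsKernel N a b O p q M H)
    (hact : ∀ k ≤ N, P.Act N k → (P.Ev N k → M k = 0) ∧ (¬ P.Ev N k → H k = 0))
    (hza : ∀ k < N, P.za k → p k = 0) (hzb : ∀ k < N, P.zb k → q k = 0) {k : ℕ} (hk : k < N) :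
    p k = 0 ∧ q k = 0 := by
  have hMH : ∀ k ≤ N, M k = 0 ∧ H k = 0 := by
    intro k hk
    induction k with
    | zero =>
      refine ⟨hK.low_zero, ?_⟩
      by_cases h : P.Ev N 0
      · exact (hK.state hP hk).1 h
      · exact (hact 0 hk h).2 h
    | succ k ih =>
      have ih := ih (by omega)
      have hk' : k < N := hk
      have hst := hK.state hP hk
      have hsl := hK.slope_step hP hk'
      have hev := P.ev_iff N hk'
      rw [hP.z_iff k hk'.le, hP.z_iff (k + 1) hk] at hev
      have hac := hact (k + 1) hk
      rw [Pattern.Act, hP.z_iff k hk'.le, hP.z_iff (k + 1) hk] at hac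
      by_cases h1 : O (k + 1) = 0
      · by_cases h0 : O k = 0
        · have := hK.flat_step hP hk' h0 h1
          by_cases hs : P.Single k <;> by_cases hza : P.za k <;> simp_all
        · have := hK.cusp_step hP hk' h0 h1
          by_cases he : P.Ev N (k + 1)
          · exact ⟨(hac (Or.inl ⟨h1, h0, he⟩)).1 he, this.2⟩
          · exact ⟨hst.2 he, this.2⟩
      · have hz : ¬ P.Ev N (k + 1) := fun h => h1 (hP.sum_eq_zero_of_ev hk h)
        refine ⟨hst.2 hz, ?_⟩
        by_cases h0 : O k = 0
        · exact (hac (Or.inr ⟨h1, h0⟩)).2 hz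
        · have := hsl.2
          rw [ih.2, zero_mul] at this
          exact (mul_eq_zero.1 this.symm).resolve_right h0
  have hs := hP.sum_step k hk
  have hl := hK.low_step k hk
  have hh := hK.high_step k hk
  have ha := hK.eq_a k hk
  have hb := hK.eq_b k hk
  have hza := hza k hk
  have hzb := hzb k hk
  rw [hP.za_iff k hk] at hza
  rw [hP.zb_iff k hk] at hzb
  rw [(hMH k hk.le).1, (hMH (k + 1) hk).1] at hl
  rw [(hMH k hk.le).2, (hMH (k + 1) hk).2] at hh
  rw [(hMH k hk.le).1, (hMH (k + 1) hk).2] at ha hb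
  by_cases h1 : O (k + 1) = 0
  · have hpa : p k * a k = 0 := by linear_combination (-hh + hl) / 2
    have hqb : q k * b k = 0 := by linear_combination (-hh - hl) / 2
    rw [mul_eq_zero] at hpa hqb
    by_cases h0 : O k = 0
    · exact ⟨hpa.elim id fun h => hza ⟨h0, h1, h⟩, hqb.elim id fun h => hzb ⟨h0, h1, h⟩⟩
    · have h2 : a k ≠ 0 := fun h => h0 (by rw [hs, h, h1]; ring)
      have h3 : b k ≠ 0 := fun h => h0 (by rw [hs, h, h1]; ring)
      exact ⟨hpa.resolve_right h2, hqb.resolve_right h3⟩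
  · simp only [sub_zero, add_zero, mul_zero, zero_eq_mul, h1, or_false] at ha hb
    simp at ha hb
    exact ⟨hb, ha⟩

end

end QPlane
end

/-! ### Kernel covectors from monomials and partial sums -/

noncomputable section
namespace QPlane

/-- An active place is never the upper end of a flat index, so the recursion is not restarted here
and obeys the signs of `IsKernel.flat_step`. -/
theorem Pattern.sgn_succ_of_flat {P : Pattern} {N k₀ k : ℕ} (hact : P.Act N k₀) (h : P.Flat k) :
    (P.Single k → P.za k → P.sgn k₀ (k + 1) = P.sgn k₀ k) ∧
    (P.Single k → ¬ P.za k → P.sgn k₀ (k + 1) = -P.sgn k₀ k) ∧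
    (¬ P.Single k → P.sgn k₀ (k + 1) = P.sgn k₀ k) := by
  have h1 : k₀ ≠ k + 1 := by
    rintro rfl
    have h2 := h.1
    have h3 := h.2
    simp only [Pattern.Act] at hact
    tauto
  refine ⟨fun hs hz => ?_, fun hs hz => ?_, fun hs => ?_⟩ <;> simp [Pattern.sgn, *]

theorem Pattern.sgn_eq_zero_of_not_z {P : Pattern} {k₀ k : ℕ} (hz : P.z k₀) (h : ¬ P.z k) :
    P.sgn k₀ k = 0 := by
  have h1 : k₀ ≠ k := fun h' => h (h' ▸ hz)
  cases k with
  | zero => simp [Pattern.sgn, h1]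
  | succ k => simp [Pattern.sgn, h1, Pattern.Flat, h]

section

variable {P : Pattern} {N : ℕ} {a b O p q : ℕ → ℂ} {k₀ : ℕ}

theorem HasPattern.not_ev_of_ne (hP : HasPattern P N a b O) {k : ℕ} (hk : k ≤ N) (h : O k ≠ 0) :
    ¬ P.Ev N k := fun h' => h (hP.sum_eq_zero_of_ev hk h')

/-- The first two claims make the monomial regular at its zero coordinates; the last two are the
kernel equations at a flat index divided by `2T`. -/
theorem HasPattern.exp_of_flat (hP : HasPattern P N a b O) (hact : P.Act N k₀)
    {k : ℕ} (hk : k < N) (h0 : O k = 0) (h1 : O (k + 1) = 0) :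
    (a k = 0 → P.expA N k₀ k = 0) ∧ (b k = 0 → P.expB N k₀ k = 0) ∧
    (a k ≠ 0 → P.lowSgn N k₀ k + P.highSgn N k₀ (k + 1) = 0) ∧
    (b k ≠ 0 → P.highSgn N k₀ (k + 1) - P.lowSgn N k₀ k = 0) := by
  have hs := hP.sum_step k hk
  have hflat : P.Flat k := ⟨(hP.z_iff k hk.le).2 h0, (hP.z_iff (k + 1) hk).2 h1⟩
  have hza : P.za k ↔ a k = 0 := by rw [hP.za_iff k hk]; tauto
  have hzb : P.zb k ↔ b k = 0 := by rw [hP.zb_iff k hk]; tauto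
  have hab : a k = 0 ∨ b k = 0 := by rw [h0, h1] at hs; simpa using hs.symm
  have hsg := Pattern.sgn_succ_of_flat hact hflat
  have hev := P.ev_iff N hk
  have hsing : P.Single k ↔ ¬ (a k = 0 ∧ b k = 0) := by
    rw [Pattern.Single, hza, hzb]; exact and_iff_right hflat
  rw [hsing] at hsg hev
  have hz0 := hflat.1
  have hz1 := hflat.2
  simp only [hz0, hz1, true_and, forall_const] at hev
  rw [hza] at hsg
  simp only [Pattern.expA, Pattern.expB, Pattern.lowSgn, Pattern.highSgn]
  generalize P.sgn k₀ k = s at hsg ⊢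
  generalize P.sgn k₀ (k + 1) = t at hsg ⊢
  clear hs hza hzb hz0 hz1 hflat hsing h0 h1 hP
  by_cases ha : a k = 0
  · by_cases hb : b k = 0
    · by_cases he : P.Ev N (k + 1) <;> simp [ha, hb, he] at hsg hev ⊢ <;> simp [hev, hsg]
    · by_cases he : P.Ev N (k + 1) <;> simp [ha, hb, he] at hsg hev ⊢ <;> simp [hev, hsg]
  · have hb := hab.resolve_left ha
    by_cases he : P.Ev N (k + 1) <;> simp [ha, hb, he] at hsg hev ⊢ <;> simp [hev, hsg]

/-- Signs live only where the sums vanish. At the foot of a slope the state is even, so only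
`lowSgn` can survive there. -/
theorem HasPattern.exp_of_slope (hP : HasPattern P N a b O) (hz : P.z k₀)
    {k : ℕ} (hk : k < N) (h1 : O (k + 1) ≠ 0) :
    P.highSgn N k₀ (k + 1) = 0 ∧ P.lowSgn N k₀ (k + 1) = 0 ∧ P.highSgn N k₀ k = 0 ∧
      (O k ≠ 0 → P.lowSgn N k₀ k = 0) := by
  have hz1 : ¬ P.z (k + 1) := by rwa [hP.z_iff _ hk]
  have he1 := hP.not_ev_of_ne hk h1
  have hs1 := Pattern.sgn_eq_zero_of_not_z hz hz1
  have hev := P.ev_iff N hk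
  simp only [Pattern.lowSgn, Pattern.highSgn, he1, hs1, if_false, true_and]
  by_cases h0 : O k = 0
  · have hz0 : P.z k := (hP.z_iff _ hk.le).2 h0
    have he : P.Ev N k := hev.2 ⟨hz0, fun h => absurd h hz1⟩
    simp [he, h0]
  · have hz0 : ¬ P.z k := by rwa [hP.z_iff _ hk.le]
    simp [Pattern.sgn_eq_zero_of_not_z hz hz0]

/-- A start just above a cusp is allowed only in the even state, and no sign is propagated across a
cusp. -/
theorem HasPattern.exp_of_cusp (hP : HasPattern P N a b O) (hact : P.Act N k₀)
    {k : ℕ} (hk : k < N) (h0 : O k ≠ 0) (h1 : O (k + 1) = 0) :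
    P.lowSgn N k₀ k = 0 ∧ P.highSgn N k₀ (k + 1) = 0 := by
  have he := hP.not_ev_of_ne hk.le h0
  have hz0 : ¬ P.z k := by rwa [hP.z_iff _ hk.le]
  refine ⟨by simp [Pattern.lowSgn, he], ?_⟩
  by_cases he1 : P.Ev N (k + 1)
  · simp [Pattern.highSgn, he1]
  · have h2 : k₀ ≠ k + 1 := by
      rintro rfl
      have hz1 : P.z (k + 1) := (hP.z_iff _ hk).2 h1
      simp only [Pattern.Act] at hact
      tauto
    simp [Pattern.highSgn, he1, Pattern.sgn, h2, Pattern.Flat, hz0]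

theorem HasPattern.left_ne_zero (hP : HasPattern P N a b O) {k : ℕ} (hk : k < N)
    (h : O k ≠ O (k + 1)) : a k ≠ 0 :=
  fun h' => h (by rw [hP.sum_step k hk, h']; ring)

theorem HasPattern.right_ne_zero (hP : HasPattern P N a b O) {k : ℕ} (hk : k < N)
    (h : O k ≠ O (k + 1)) : b k ≠ 0 :=
  fun h' => h (by rw [hP.sum_step k hk, h']; ring)

theorem HasPattern.exp_eq_zero (hP : HasPattern P N a b O) (hact : P.Act N k₀) (hz : P.z k₀)
    {k : ℕ} (hk : k < N) :
    (a k = 0 → P.expA N k₀ k = 0) ∧ (b k = 0 → P.expB N k₀ k = 0) := by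
  by_cases h1 : O (k + 1) = 0
  · by_cases h0 : O k = 0
    · have := hP.exp_of_flat hact hk h0 h1
      exact ⟨this.1, this.2.1⟩
    · have h2 : O k ≠ O (k + 1) := by rwa [h1]
      exact ⟨fun h => absurd h (hP.left_ne_zero hk h2), fun h => absurd h (hP.right_ne_zero hk h2)⟩
  · by_cases h0 : O k = 0
    · have h2 : O k ≠ O (k + 1) := by rw [h0]; exact Ne.symm h1
      exact ⟨fun h => absurd h (hP.left_ne_zero hk h2), fun h => absurd h (hP.right_ne_zero hk h2)⟩
    · have := hP.exp_of_slope hz hk h1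
      simp [Pattern.expA, Pattern.expB, this.1, this.2.1, this.2.2.1, this.2.2.2 h0]

theorem lowSgn_zero (hact : P.Act N k₀) : P.lowSgn N k₀ 0 = 0 := by
  by_cases h : k₀ = 0
  · subst h
    have : ¬ P.Ev N 0 := hact
    simp [Pattern.lowSgn, this]
  · simp [Pattern.lowSgn, Pattern.sgn, h]

/-- The differential of the Casimir function which starts at `k₀`, whose value is `T`. -/
theorem HasPattern.isKernel_casimir (hP : HasPattern P N a b O) (hact : P.Act N k₀) (hz : P.z k₀)
    {T : ℂ} (hp : ∀ k < N, p k * a k = P.expA N k₀ k * T)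
    (hq : ∀ k < N, q k * b k = P.expB N k₀ k * T)
    (hp0 : ∀ k < N, P.expA N k₀ k = 0 → p k = 0) (hq0 : ∀ k < N, P.expB N k₀ k = 0 → q k = 0) :
    IsKernel N a b O p q (fun k => 2 * T * P.lowSgn N k₀ k) (fun k => 2 * T * P.highSgn N k₀ k) := by
  have key : ∀ k < N,
      a k * (2 * T * P.lowSgn N k₀ k + 2 * T * P.highSgn N k₀ (k + 1)) = 2 * q k * O (k + 1) ∧
      b k * (2 * T * P.highSgn N k₀ (k + 1) - 2 * T * P.lowSgn N k₀ k) = 2 * p k * O (k + 1) := by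
    intro k hk
    have hs := hP.sum_step k hk
    by_cases h1 : O (k + 1) = 0
    · rw [h1, mul_zero, mul_zero, mul_eq_zero, mul_eq_zero, or_iff_not_imp_left,
        or_iff_not_imp_left]
      by_cases h0 : O k = 0
      · obtain ⟨-, -, h3, h4⟩ := hP.exp_of_flat hact hk h0 h1
        refine ⟨fun h => ?_, fun h => ?_⟩
        · have := congrArg (Int.cast (R := ℂ)) (h3 h)
          push_cast at this
          linear_combination 2 * T * this
        · have := congrArg (Int.cast (R := ℂ)) (h4 h)
          push_cast at this
          linear_combination 2 * T * this
      · have := hP.exp_of_cusp hact hk h0 h1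
        simp [this.1, this.2]
    · obtain ⟨h2, h3, h4, h5⟩ := hP.exp_of_slope hz hk h1
      by_cases h0 : O k = 0
      · have h6 : O k ≠ O (k + 1) := by rw [h0]; exact Ne.symm h1
        have ha := hP.left_ne_zero hk h6
        have hb := hP.right_ne_zero hk h6
        have hpk := hp k hk
        have hqk := hq k hk
        simp only [Pattern.expA, Pattern.expB, h2, h3, h4] at hpk hqk
        push_cast at hpk hqk
        -- At the foot of a slope the exponents of `a_k` and `b_k` are `±lowSgn`, and this value of
        -- `Ω_{k+1}` balances both equations.
        have h7 : O (k + 1) = -(a k * b k) := by linear_combination h0 - hs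
        rw [h2, h7]
        push_cast
        constructor
        · linear_combination 2 * a k * hqk
        · linear_combination 2 * b k * hpk
      · have hA : P.expA N k₀ k = 0 := by simp [Pattern.expA, h2, h3, h4, h5 h0]
        have hB : P.expB N k₀ k = 0 := by simp [Pattern.expB, h2, h3, h4, h5 h0]
        simp [h2, h5 h0, hp0 k hk hA, hq0 k hk hB]
  refine ⟨?_, ?_, ?_, ?_, fun k hk => (key k hk).1, fun k hk => (key k hk).2⟩
  · simp [lowSgn_zero hact]
  · intro k hk
    have hpk := hp k hk
    have hqk := hq k hk
    simp only [Pattern.expA, Pattern.expB] at hpk hqk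
    push_cast at hpk hqk
    linear_combination hpk - hqk
  · simp [Pattern.highSgn, P.ev_top N]
  · intro k hk
    have hpk := hp k hk
    have hqk := hq k hk
    simp only [Pattern.expA, Pattern.expB] at hpk hqk
    push_cast at hpk hqk
    linear_combination -hpk - hqk

/-- The differential of the partial sum from `j`. -/
theorem HasPattern.isKernel_sum (hP : HasPattern P N a b O) {j : ℕ} (hj : j ≤ N)
    (h : j = 0 ∨ O j = 0) :
    IsKernel N a b O (fun i => if j ≤ i then b i else 0) (fun i => if j ≤ i then a i else 0)
      (fun _ => 0) (fun k => 2 * O (max j k)) := by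
  refine ⟨rfl, ?_, ?_, ?_, ?_, ?_⟩
  · intro k hk
    split_ifs <;> ring
  · simp [max_eq_right hj, hP.sum_top]
  · intro k hk
    by_cases hjk : j ≤ k
    · simp only [hjk, if_true, max_eq_right hjk, max_eq_right (Nat.le_succ_of_le hjk)]
      rw [hP.sum_step k hk]; ring
    · simp [hjk, max_eq_left (show k ≤ j by omega), max_eq_left (show k + 1 ≤ j by omega)]
  · intro k hk
    by_cases hjk : j ≤ k
    · simp only [hjk, if_true, max_eq_right (Nat.le_succ_of_le hjk)]; ring
    -- Below `j` the left side is `2 a_k Ω_j`, so `Ω_j = 0` is what makes the partial sum a Casimir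
    -- here.
    · have h0 : O j = 0 := h.resolve_left (by omega)
      simp [hjk, max_eq_left (show k + 1 ≤ j by omega), h0]
  · intro k hk
    by_cases hjk : j ≤ k
    · simp only [hjk, if_true, max_eq_right (Nat.le_succ_of_le hjk)]; ring
    · have h0 : O j = 0 := h.resolve_left (by omega)
      simp [hjk, max_eq_left (show k + 1 ≤ j by omega), h0]

end

end QPlane
end

/-! ### The Poisson tensor in coordinates -/

noncomputable section
namespace QPlane

variable {N : ℕ}

/-- The coordinates `a_k` as a sequence, continued by zero. -/
def seqA (x : Phase N) (k : ℕ) : ℂ := if h : k < N then x (.inl ⟨k, h⟩) else 0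

/-- The coordinates `a_k^*` as a sequence, continued by zero. -/
def seqB (x : Phase N) (k : ℕ) : ℂ := if h : k < N then x (.inr ⟨k, h⟩) else 0

@[simp] theorem seqA_coe (x : Phase N) (j : Fin N) : seqA x j = x (.inl j) := by simp [seqA]

@[simp] theorem seqB_coe (x : Phase N) (j : Fin N) : seqB x j = x (.inr j) := by simp [seqB]

/-- The sum of `ξ_{a_i^*} a_i^* - ξ_{a_i} a_i` over the indices below `k`. -/
def low (x ξ : Phase N) (k : ℕ) : ℂ :=
  ∑ i ∈ Finset.range k, (seqB ξ i * seqB x i - seqA ξ i * seqA x i)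

/-- The sum of `ξ_{a_i} a_i + ξ_{a_i^*} a_i^*` over the indices from `k` on. -/
def high (x ξ : Phase N) (k : ℕ) : ℂ :=
  ∑ i ∈ Finset.Ico k N, (seqA ξ i * seqA x i + seqB ξ i * seqB x i)

theorem sum_fin_ite (p : ℕ → Prop) [DecidablePred p] (g : ℕ → ℂ) :
    ∑ j : Fin N, (if p j then g j else 0) = ∑ j ∈ (Finset.range N).filter p, g j := by
  rw [Fin.sum_univ_eq_sum_range (fun j => if p j then g j else 0), Finset.sum_filter]

theorem low_eq_sum (x ξ : Phase N) {k : ℕ} (hk : k ≤ N) :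
    low x ξ k = ∑ i : Fin N, if (i : ℕ) < k
      then ξ (.inr i) * x (.inr i) - ξ (.inl i) * x (.inl i) else 0 := by
  have := sum_fin_ite (N := N) (fun i => i < k)
    (fun i => seqB ξ i * seqB x i - seqA ξ i * seqA x i)
  simp only [seqA_coe, seqB_coe] at this
  rw [this, low]
  congr 1
  ext i
  simp only [Finset.mem_range, Finset.mem_filter]
  omega

theorem high_eq_sum (x ξ : Phase N) (k : ℕ) :
    high x ξ k = ∑ i : Fin N, if k ≤ (i : ℕ)
      then ξ (.inl i) * x (.inl i) + ξ (.inr i) * x (.inr i) else 0 := by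
  have := sum_fin_ite (N := N) (fun i => k ≤ i)
    (fun i => seqA ξ i * seqA x i + seqB ξ i * seqB x i)
  simp only [seqA_coe, seqB_coe] at this
  rw [this, high]
  congr 1
  ext i
  simp only [Finset.mem_range, Finset.mem_filter, Finset.mem_Ico]
  omega

theorem partialSum_eq (x : Phase N) (k : ℕ) :
    partialSum x k = ∑ i ∈ Finset.Ico k N, seqA x i * seqB x i := by
  have := sum_fin_ite (N := N) (fun i => k ≤ i) (fun i => seqA x i * seqB x i)
  simp only [seqA_coe, seqB_coe] at this
  rw [partialSum, Finset.sum_filter, this]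
  congr 1
  ext i
  simp only [Finset.mem_range, Finset.mem_filter, Finset.mem_Ico]
  omega

theorem partialSum_top (x : Phase N) : partialSum x N = 0 := by simp [partialSum_eq]

theorem partialSum_step (x : Phase N) {k : ℕ} (hk : k < N) :
    partialSum x k = seqA x k * seqB x k + partialSum x (k + 1) := by
  rw [partialSum_eq, partialSum_eq, Finset.sum_eq_sum_Ico_succ_bot hk]

/-- The vanishing pattern of a point. -/
def patternOf (x : Phase N) : Pattern where
  z k := partialSum x k = 0
  za k := partialSum x k = 0 ∧ partialSum x (k + 1) = 0 ∧ seqA x k = 0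
  zb k := partialSum x k = 0 ∧ partialSum x (k + 1) = 0 ∧ seqB x k = 0

theorem hasPattern (x : Phase N) :
    HasPattern (patternOf x) N (seqA x) (seqB x) (partialSum x) where
  sum_top := partialSum_top x
  sum_step _ hk := partialSum_step x hk
  z_iff _ _ := Iff.rfl
  za_iff _ _ := Iff.rfl
  zb_iff _ _ := Iff.rfl

/-- The contraction of a covector with the Poisson structure at `x`. -/
def poissonMap (x : Phase N) : Phase N →ₗ[ℂ] Phase N where
  toFun ξ v := ∑ u, poissonMatrix x u v * ξ u
  map_add' ξ η := by ext v; simp [mul_add, Finset.sum_add_distrib]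
  map_smul' c ξ := by
    ext v
    simp only [Pi.smul_apply, smul_eq_mul, RingHom.id_apply, Finset.mul_sum, mul_left_comm]

theorem poissonMatrix_antisymm (x : Phase N) (u v : Fin N ⊕ Fin N) :
    poissonMatrix x u v = -poissonMatrix x v u := by
  rcases u with i | i <;> rcases v with j | j <;> simp only [poissonMatrix]
  · rcases lt_trichotomy i j with h | h | h <;> simp [h, h.not_gt]
  · by_cases h : i = j
    · subst h; simp
    · simp [h, Ne.symm h]
  · by_cases h : i = j
    · subst h; simp
    · simp [h, Ne.symm h]
  · rcases lt_trichotomy i j with h | h | h <;> simp [h, h.not_gt]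

theorem partialSum_succ_eq (x : Phase N) (j : Fin N) :
    ∑ k ∈ Finset.univ.filter (fun k => j < k), x (.inl k) * x (.inr k) =
      partialSum x (j + 1) := by
  rw [partialSum]
  congr 1

/-- Every bracket with `a_j` other than that of `a_j^*` is `a_j` times a signed coordinate, or zero:
indices below `j` assemble to `low`, those above to `high`, and `j` itself gives the `Ω_{j+1}` term.
-/
theorem poissonMap_inl (x ξ : Phase N) (j : Fin N) :
    poissonMap x ξ (.inl j) = seqA x j * (low x ξ j + high x ξ (j + 1))
      - 2 * seqB ξ j * partialSum x (j + 1) := by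
  have h1 : 2 * seqB ξ j * partialSum x (j + 1) =
      ∑ i : Fin N, if i = j then 2 * ξ (.inr i) * partialSum x (j + 1) else 0 := by simp
  rw [h1, low_eq_sum x ξ j.2.le, high_eq_sum, seqA_coe, ← Finset.sum_add_distrib, Finset.mul_sum,
    ← Finset.sum_sub_distrib]
  change ∑ u, poissonMatrix x u (.inl j) * ξ u = _
  rw [Fintype.sum_sum_type, ← Finset.sum_add_distrib]
  refine Finset.sum_congr rfl fun i _ => ?_
  simp only [poissonMatrix, partialSum_succ_eq, Nat.succ_le_iff, Fin.val_fin_lt]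
  rcases lt_trichotomy i j with h | h | h
  · simp only [h, h.not_gt, h.ne, if_true, if_false]; ring
  · subst h; simp; ring
  · simp only [h, h.not_gt, h.ne', if_true, if_false]; ring

theorem poissonMap_inr (x ξ : Phase N) (j : Fin N) :
    poissonMap x ξ (.inr j) = 2 * seqA ξ j * partialSum x (j + 1) -
      seqB x j * (high x ξ (j + 1) - low x ξ j) := by
  have h1 : 2 * seqA ξ j * partialSum x (j + 1) =
      ∑ i : Fin N, if i = j then 2 * ξ (.inl i) * partialSum x (j + 1) else 0 := by simp
  rw [h1, low_eq_sum x ξ j.2.le, high_eq_sum, seqB_coe, ← Finset.sum_sub_distrib, Finset.mul_sum,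
    ← Finset.sum_sub_distrib]
  change ∑ u, poissonMatrix x u (.inr j) * ξ u = _
  rw [Fintype.sum_sum_type, ← Finset.sum_add_distrib]
  refine Finset.sum_congr rfl fun i _ => ?_
  simp only [poissonMatrix, partialSum_succ_eq, Nat.succ_le_iff, Fin.val_fin_lt]
  rcases lt_trichotomy i j with h | h | h
  · simp only [h, h.not_gt, h.ne, if_true, if_false]; ring
  · subst h; simp; ring
  · simp only [h, h.not_gt, h.ne', if_true, if_false]; ring

theorem isKernel_iff (x ξ : Phase N) : poissonMap x ξ = 0 ↔
    IsKernel N (seqA x) (seqB x) (partialSum x) (seqA ξ) (seqB ξ) (low x ξ) (high x ξ) := by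
  constructor
  · intro h
    refine ⟨by simp [low], ?_, by simp [high], ?_, ?_, ?_⟩
    · intro k _; rw [low, low, Finset.sum_range_succ]
    · intro k hk; rw [high, high, Finset.sum_eq_sum_Ico_succ_bot hk]; ring
    · intro k hk
      have h1 := poissonMap_inl x ξ ⟨k, hk⟩
      rw [h] at h1
      exact sub_eq_zero.1 h1.symm
    · intro k hk
      have h1 := poissonMap_inr x ξ ⟨k, hk⟩
      rw [h] at h1
      exact (sub_eq_zero.1 h1.symm).symm
  · intro h
    ext v
    rcases v with j | j
    · rw [poissonMap_inl, h.eq_a j j.2]; simp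
    · rw [poissonMap_inr, h.eq_b j j.2]; simp

theorem IsKernel.low_eq {x ξ : Phase N} {M H : ℕ → ℂ}
    (h : IsKernel N (seqA x) (seqB x) (partialSum x) (seqA ξ) (seqB ξ) M H) {k : ℕ}
    (hk : k ≤ N) : low x ξ k = M k := by
  induction k with
  | zero => simp [low, h.low_zero]
  | succ k ih => rw [h.low_step k hk, ← ih (by omega), low, low, Finset.sum_range_succ]

theorem IsKernel.high_eq {x ξ : Phase N} {M H : ℕ → ℂ}
    (h : IsKernel N (seqA x) (seqB x) (partialSum x) (seqA ξ) (seqB ξ) M H) {k : ℕ}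
    (hk : k ≤ N) : high x ξ k = H k := by
  refine descending_induction (p := fun k => high x ξ k = H k) ?_ ?_ k hk
  · simp [high, h.high_top]
  · intro k hk ih
    rw [h.high_step k hk, ← ih, high, high, Finset.sum_eq_sum_Ico_succ_bot hk]; ring

/-- The recursions and boundary values determine `M` and `H`, so any guessed sequences satisfying
them are `low` and `high`. -/
theorem IsKernel.poissonMap_eq_zero {x ξ : Phase N} {M H : ℕ → ℂ}
    (h : IsKernel N (seqA x) (seqB x) (partialSum x) (seqA ξ) (seqB ξ) M H) :
    poissonMap x ξ = 0 := by
  rw [isKernel_iff]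
  refine ⟨by simp [low], ?_, by simp [high], ?_, ?_, ?_⟩
  · intro k hk; rw [h.low_eq hk, h.low_eq hk.le, h.low_step k hk]
  · intro k hk; rw [h.high_eq hk, h.high_eq hk.le, h.high_step k hk]
  · intro k hk; rw [h.high_eq hk, h.low_eq hk.le, h.eq_a k hk]
  · intro k hk; rw [h.high_eq hk, h.low_eq hk.le, h.eq_b k hk]

/-- The linear function with coefficients `ξ`. -/
def covector (ξ : Phase N) : Phase N →L[ℂ] ℂ :=
  ∑ u, ξ u • ContinuousLinearMap.proj (R := ℂ) (φ := fun _ : Fin N ⊕ Fin N => ℂ) u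

theorem covector_apply (ξ v : Phase N) : covector ξ v = ∑ u, ξ u * v u := by
  simp [covector]

theorem covector_single (ξ : Phase N) (u : Fin N ⊕ Fin N) :
    covector ξ (Pi.single u 1) = ξ u := by
  simp [covector_apply, Pi.single_apply]

theorem hamiltonianField_eq (f : Phase N → ℂ) (x : Phase N) :
    hamiltonianField f x = poissonMap x (fun u => partialDeriv f u x) := rfl

theorem hamiltonianDistribution_eq_range (x : Phase N) :
    hamiltonianDistribution x = LinearMap.range (poissonMap x) := by
  apply le_antisymm
  · refine Submodule.span_le.2 ?_
    rintro _ ⟨f, -, rfl⟩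
    exact ⟨_, (hamiltonianField_eq f x).symm⟩
  · rintro _ ⟨ξ, rfl⟩
    refine Submodule.subset_span ⟨covector ξ, (covector ξ).differentiable, ?_⟩
    rw [hamiltonianField_eq]
    congr 1
    ext u
    rw [partialDeriv, ContinuousLinearMap.fderiv, covector_single]

/-- Antisymmetry turns a gradient in the kernel into a function with zero derivative along the
distribution. -/
theorem covector_poissonMap (x ξ c : Phase N) :
    covector ξ (poissonMap x c) = -covector c (poissonMap x ξ) := by
  rw [covector_apply, covector_apply]
  change ∑ v, ξ v * ∑ u, poissonMatrix x u v * c u = -∑ v, c v * ∑ u, poissonMatrix x u v * ξ u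
  simp only [Finset.mul_sum]
  rw [Finset.sum_comm, ← Finset.sum_neg_distrib]
  refine Finset.sum_congr rfl fun u _ => ?_
  rw [← Finset.sum_neg_distrib]
  refine Finset.sum_congr rfl fun v _ => ?_
  rw [poissonMatrix_antisymm x u v]; ring

end QPlane
end

/-! ### The invariants and their gradients -/

noncomputable section
namespace QPlane

section monomial

variable {ι : Type*} [Fintype ι]

theorem contDiffAt_zpow_apply (u : ι) (e : ℤ) {x : ι → ℂ} (h : x u = 0 → e = 0) :
    ContDiffAt ℂ ω (fun y : ι → ℂ => y u ^ e) x := by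
  by_cases hx : x u = 0
  · simpa [h hx] using contDiffAt_const
  · have h1 : AnalyticAt ℂ (fun z : ℂ => z ^ e) (x u) :=
      AnalyticAt.zpow (f := fun z : ℂ => z) analyticAt_id hx
    exact ContDiffAt.comp (g := fun z : ℂ => z ^ e) x h1.contDiffAt (contDiff_apply ℂ ℂ u).contDiffAt

/-- The logarithmic form of the derivative stays valid at `x u = 0`: there `e = 0`, so the function
is constant and the coefficient is zero. -/
theorem hasFDerivAt_zpow_apply (u : ι) (e : ℤ) {x : ι → ℂ} (h : x u = 0 → e = 0) :
    HasFDerivAt (fun y : ι → ℂ => y u ^ e)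
      ((x u ^ e * (e / x u)) • ContinuousLinearMap.proj (R := ℂ) (φ := fun _ : ι => ℂ) u) x := by
  by_cases hx : x u = 0
  · obtain rfl := h hx
    refine HasFDerivAt.congr_fderiv (f' := 0)
      (by simpa using hasFDerivAt_const (𝕜 := ℂ) (1 : ℂ) x) ?_
    ext v
    simp
  · have h1 := (hasDerivAt_zpow e (x u) (Or.inl hx)).comp_hasFDerivAt x
      (ContinuousLinearMap.proj (R := ℂ) (φ := fun _ : ι => ℂ) u).hasFDerivAt
    refine h1.congr_fderiv ?_
    congr 1
    rw [zpow_sub_one₀ hx]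
    field_simp

theorem contDiffAt_prod_zpow (e : ι → ℤ) {x : ι → ℂ} (h : ∀ u, x u = 0 → e u = 0) :
    ContDiffAt ℂ ω (fun y : ι → ℂ => ∏ u, y u ^ e u) x :=
  contDiffAt_prod fun u _ => contDiffAt_zpow_apply u (e u) (h u)

theorem hasFDerivAt_prod_zpow (e : ι → ℤ) {x : ι → ℂ} (h : ∀ u, x u = 0 → e u = 0) :
    HasFDerivAt (fun y : ι → ℂ => ∏ u, y u ^ e u)
      (∑ u, (e u * (∏ v, x v ^ e v) / x u) •
        ContinuousLinearMap.proj (R := ℂ) (φ := fun _ : ι => ℂ) u) x := by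
  classical
  have key : ∀ s : Finset ι, HasFDerivAt (fun y : ι → ℂ => ∏ u ∈ s, y u ^ e u)
      (∑ u ∈ s, (e u * (∏ v ∈ s, x v ^ e v) / x u) •
        ContinuousLinearMap.proj (R := ℂ) (φ := fun _ : ι => ℂ) u) x := by
    intro s
    induction s using Finset.induction_on with
    | empty => simpa using hasFDerivAt_const (1 : ℂ) x
    | insert u s hu ih =>
      have h1 := (hasFDerivAt_zpow_apply u (e u) (h u)).mul ih
      simp only [Finset.prod_insert hu, Finset.sum_insert hu]
      refine h1.congr_fderiv ?_
      rw [add_comm, Finset.smul_sum, smul_smul]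
      congr 1
      · congr 1; ring
      · refine Finset.sum_congr rfl fun v _ => ?_
        rw [smul_smul]
        congr 1; ring
  exact key Finset.univ

end monomial

variable {N : ℕ}

namespace Pattern

variable (P : Pattern) (N)

/-- The coordinates which vanish, among those recorded by the pattern. -/
def ZeroCoord : Fin N ⊕ Fin N → Prop
  | .inl j => P.za j
  | .inr j => P.zb j

/-- The exponents of the Casimir function which starts at `k₀`. -/
def exponent (k₀ : ℕ) : Fin N ⊕ Fin N → ℤ
  | .inl j => P.expA N k₀ j
  | .inr j => P.expB N k₀ j

/-- The index set of the functions which define the leaves with the given pattern. -/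
abbrev Index : Type := {u : Fin N ⊕ Fin N // P.ZeroCoord N u} ⊕ {k : Fin (N + 1) // P.Act N k}

/-- The Casimir function which starts at `k₀`. -/
def casimir (k₀ : ℕ) (x : Phase N) : ℂ := ∏ u, x u ^ P.exponent N k₀ u

open Classical in
/-- The functions which are constant on the leaves with the given pattern. -/
def invariant : P.Index N → Phase N → ℂ
  | .inl u, x => x u
  | .inr k, x => if P.z k then P.casimir N k x else partialSum x (k - 1)

/-- The gradient of `partialSum · j`. -/
def sumGrad (j : ℕ) (x : Phase N) : Phase N
  | .inl i => if j ≤ i then x (.inr i) else 0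
  | .inr i => if j ≤ i then x (.inl i) else 0

/-- The gradient of `Pattern.casimir`. -/
def casimirGrad (k₀ : ℕ) (x : Phase N) : Phase N :=
  fun u => P.exponent N k₀ u * P.casimir N k₀ x / x u

open Classical in
/-- The gradient of `Pattern.invariant`. -/
def grad : P.Index N → Phase N → Phase N
  | .inl u, _ => Pi.single (u : Fin N ⊕ Fin N) 1
  | .inr k, x => if P.z k then P.casimirGrad N k x else sumGrad N (k - 1) x

end Pattern

theorem contDiff_partialSum (k : ℕ) : ContDiff ℂ ω (fun x : Phase N => partialSum x k) := by
  unfold partialSum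
  exact ContDiff.sum fun i _ => (contDiff_apply ℂ ℂ _).mul (contDiff_apply ℂ ℂ _)

theorem hasFDerivAt_partialSum (k : ℕ) (x : Phase N) :
    HasFDerivAt (fun x : Phase N => partialSum x k) (covector (Pattern.sumGrad N k x)) x := by
  have h1 : HasFDerivAt (fun x : Phase N => partialSum x k)
      (∑ j ∈ Finset.univ.filter (fun j : Fin N => k ≤ (j : ℕ)),
        (x (.inl j) • ContinuousLinearMap.proj (R := ℂ) (φ := fun _ : Fin N ⊕ Fin N => ℂ) (.inr j)
        + x (.inr j) • ContinuousLinearMap.proj (R := ℂ) (φ := fun _ : Fin N ⊕ Fin N => ℂ)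
            (.inl j))) x := by
    unfold partialSum
    refine HasFDerivAt.fun_sum fun i _ => ?_
    exact (ContinuousLinearMap.proj (R := ℂ) (φ := fun _ : Fin N ⊕ Fin N => ℂ)
      (.inl i)).hasFDerivAt.mul (ContinuousLinearMap.proj (R := ℂ)
        (φ := fun _ : Fin N ⊕ Fin N => ℂ) (.inr i)).hasFDerivAt
  refine h1.congr_fderiv ?_
  ext v
  rw [covector_apply, Fintype.sum_sum_type, ← Finset.sum_add_distrib, Finset.sum_filter]
  simp only [sum_apply]
  refine Finset.sum_congr rfl fun i _ => ?_
  by_cases h : k ≤ (i : ℕ)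
  · simp [Pattern.sumGrad, h, add_comm]
  · simp [Pattern.sumGrad, h]

section

variable {P : Pattern} {x : Phase N}

theorem exponent_eq_zero (hP : patternOf x = P) {k₀ : ℕ} (hact : P.Act N k₀) (hz : P.z k₀)
    (u : Fin N ⊕ Fin N) (hu : x u = 0) : P.exponent N k₀ u = 0 := by
  have h := hP ▸ hasPattern x
  rcases u with j | j
  · exact (h.exp_eq_zero hact hz j.2).1 (by simpa using hu)
  · exact (h.exp_eq_zero hact hz j.2).2 (by simpa using hu)

theorem contDiffAt_invariant (hP : patternOf x = P) (γ : P.Index N) :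
    ContDiffAt ℂ ω (P.invariant N γ) x := by
  rcases γ with u | k
  · exact (contDiff_apply ℂ ℂ _).contDiffAt
  · by_cases hz : P.z k
    · have h1 : P.invariant N (.inr k) = P.casimir N k := by
        ext y; simp [Pattern.invariant, hz]
      rw [h1]
      exact contDiffAt_prod_zpow _ (exponent_eq_zero hP k.2 hz)
    · have h1 : P.invariant N (.inr k) = fun y => partialSum y (k - 1) := by
        ext y; simp [Pattern.invariant, hz]
      rw [h1]
      exact (contDiff_partialSum _).contDiffAt

theorem hasFDerivAt_invariant (hP : patternOf x = P) (γ : P.Index N) :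
    HasFDerivAt (P.invariant N γ) (covector (P.grad N γ x)) x := by
  rcases γ with u | k
  · have h1 : covector (P.grad N (.inl u) x) =
        ContinuousLinearMap.proj (R := ℂ) (φ := fun _ : Fin N ⊕ Fin N => ℂ) (u : Fin N ⊕ Fin N) := by
      ext v
      simp [covector_apply, Pattern.grad, Pi.single_apply, -Fintype.sum_sum_type]
    rw [h1]
    exact (ContinuousLinearMap.proj (R := ℂ) (φ := fun _ : Fin N ⊕ Fin N => ℂ)
      (u : Fin N ⊕ Fin N)).hasFDerivAt
  · by_cases hz : P.z k
    · have h1 : P.invariant N (.inr k) = P.casimir N k := by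
        ext y; simp [Pattern.invariant, hz]
      have h2 : P.grad N (.inr k) x = P.casimirGrad N k x := by simp [Pattern.grad, hz]
      rw [h1, h2]
      exact hasFDerivAt_prod_zpow _ (exponent_eq_zero hP k.2 hz)
    · have h1 : P.invariant N (.inr k) = fun y => partialSum y (k - 1) := by
        ext y; simp [Pattern.invariant, hz]
      have h2 : P.grad N (.inr k) x = Pattern.sumGrad N (k - 1) x := by simp [Pattern.grad, hz]
      rw [h1, h2]
      exact hasFDerivAt_partialSum _ _

theorem isKernel_casimirGrad (hP : patternOf x = P) {k₀ : ℕ} (hact : P.Act N k₀) (hz : P.z k₀) :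
    IsKernel N (seqA x) (seqB x) (partialSum x) (seqA (P.casimirGrad N k₀ x))
      (seqB (P.casimirGrad N k₀ x)) (fun k => 2 * P.casimir N k₀ x * P.lowSgn N k₀ k)
      (fun k => 2 * P.casimir N k₀ x * P.highSgn N k₀ k) := by
  have h := hP ▸ hasPattern x
  refine h.isKernel_casimir hact hz ?_ ?_ ?_ ?_
  · intro k hk
    by_cases h0 : x (.inl ⟨k, hk⟩) = 0
    · have h1 : P.expA N k₀ k = 0 := exponent_eq_zero hP hact hz _ h0
      simp [seqA, hk, Pattern.casimirGrad, h0, h1]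
    · simp [seqA, hk, Pattern.casimirGrad, h0, Pattern.exponent]
  · intro k hk
    by_cases h0 : x (.inr ⟨k, hk⟩) = 0
    · have h1 : P.expB N k₀ k = 0 := exponent_eq_zero hP hact hz _ h0
      simp [seqB, hk, Pattern.casimirGrad, h0, h1]
    · simp [seqB, hk, Pattern.casimirGrad, h0, Pattern.exponent]
  · intro k hk h0
    simp [seqA, hk, Pattern.casimirGrad, Pattern.exponent, h0]
  · intro k hk h0
    simp [seqB, hk, Pattern.casimirGrad, Pattern.exponent, h0]

theorem isKernel_sumGrad (x : Phase N) {j : ℕ} (hj : j ≤ N) (h : j = 0 ∨ partialSum x j = 0) :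
    IsKernel N (seqA x) (seqB x) (partialSum x) (seqA (Pattern.sumGrad N j x))
      (seqB (Pattern.sumGrad N j x)) (fun _ => 0) (fun k => 2 * partialSum x (max j k)) := by
  have h1 := (hasPattern x).isKernel_sum hj h
  refine ⟨h1.low_zero, ?_, h1.high_top, ?_, ?_, ?_⟩
  · intro k hk
    have := h1.low_step k hk
    simpa [seqA, seqB, hk, Pattern.sumGrad] using this
  · intro k hk
    have := h1.high_step k hk
    simpa [seqA, seqB, hk, Pattern.sumGrad] using this
  · intro k hk
    have := h1.eq_a k hk
    simpa [seqA, seqB, hk, Pattern.sumGrad] using this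
  · intro k hk
    have := h1.eq_b k hk
    simpa [seqA, seqB, hk, Pattern.sumGrad] using this

/-- The coordinate vanishes, so it contributes nothing to `M` or `H`; the following partial sum
vanishes, so the right-hand sides do too. -/
theorem isKernel_single {u : Fin N ⊕ Fin N} (hu : (patternOf x).ZeroCoord N u) :
    IsKernel N (seqA x) (seqB x) (partialSum x) (seqA (Pi.single u 1 : Phase N))
      (seqB (Pi.single u 1 : Phase N)) (fun _ => 0) (fun _ => 0) := by
  rcases u with j | j
  · obtain ⟨h0, h1, h2⟩ := hu
    refine ⟨rfl, ?_, rfl, ?_, ?_, ?_⟩ <;> intro k hk <;> by_cases hj : k = j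
    all_goals first
      | (subst hj; simp [seqA, seqB, h1] at h2 ⊢; try simp [h2])
      | (have hj' : (⟨k, hk⟩ : Fin N) ≠ j := fun h => hj (congrArg Fin.val h)
         simp [seqA, seqB, hk, hj'])
  · obtain ⟨h0, h1, h2⟩ := hu
    refine ⟨rfl, ?_, rfl, ?_, ?_, ?_⟩ <;> intro k hk <;> by_cases hj : k = j
    all_goals first
      | (subst hj; simp [seqA, seqB, h1] at h2 ⊢; try simp [h2])
      | (have hj' : (⟨k, hk⟩ : Fin N) ≠ j := fun h => hj (congrArg Fin.val h)
         simp [seqA, seqB, hk, hj'])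

end

end QPlane
end

/-! ### Independence of the gradients and the rank of the distribution -/

noncomputable section
namespace QPlane

variable {N : ℕ}

/-- The coefficients of a relation are killed in order of increasing `b`. -/
theorem linearIndependent_of_triangular {ι V : Type*} [Fintype ι] [AddCommGroup V] [Module ℂ V]
    {v : ι → V} (θ : ι → V →ₗ[ℂ] ℂ) (b : ι → ℕ) (hd : ∀ i, θ i (v i) ≠ 0)
    (ho : ∀ i j, j ≠ i → b i ≤ b j → θ i (v j) = 0) : LinearIndependent ℂ v := by
  classical
  rw [Fintype.linearIndependent_iff]
  intro c hc
  have key : ∀ n i, b i = n → c i = 0 := by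
    intro n
    induction n using Nat.strong_induction_on with
    | _ n ih =>
      intro i hi
      have h1 := congrArg (θ i) hc
      rw [map_sum, map_zero, Finset.sum_eq_single i] at h1
      · simpa [hd i] using h1
      · intro j _ hj
        rcases lt_or_ge (b j) (b i) with h | h
        · rw [ih (b j) (hi ▸ h) j rfl]; simp
        · simp [ho i j hj h]
      · simp
  exact fun i => key _ i rfl

theorem seqA_add (x y : Phase N) (k : ℕ) : seqA (x + y) k = seqA x k + seqA y k := by
  by_cases h : k < N <;> simp [seqA, h]

theorem seqB_add (x y : Phase N) (k : ℕ) : seqB (x + y) k = seqB x k + seqB y k := by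
  by_cases h : k < N <;> simp [seqB, h]

theorem seqA_smul (c : ℂ) (x : Phase N) (k : ℕ) : seqA (c • x) k = c * seqA x k := by
  by_cases h : k < N <;> simp [seqA, h]

theorem seqB_smul (c : ℂ) (x : Phase N) (k : ℕ) : seqB (c • x) k = c * seqB x k := by
  by_cases h : k < N <;> simp [seqB, h]

/-- `low` as a linear function of the covector. -/
def lowMap (x : Phase N) (k : ℕ) : Phase N →ₗ[ℂ] ℂ where
  toFun ξ := low x ξ k
  map_add' ξ η := by
    simp only [low, ← Finset.sum_add_distrib, seqA_add, seqB_add]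
    exact Finset.sum_congr rfl fun i _ => by ring
  map_smul' c ξ := by
    simp only [low, seqA_smul, seqB_smul, RingHom.id_apply, smul_eq_mul, Finset.mul_sum]
    exact Finset.sum_congr rfl fun i _ => by ring

/-- `high` as a linear function of the covector. -/
def highMap (x : Phase N) (k : ℕ) : Phase N →ₗ[ℂ] ℂ where
  toFun ξ := high x ξ k
  map_add' ξ η := by
    simp only [high, ← Finset.sum_add_distrib, seqA_add, seqB_add]
    exact Finset.sum_congr rfl fun i _ => by ring
  map_smul' c ξ := by
    simp only [high, seqA_smul, seqB_smul, RingHom.id_apply, smul_eq_mul, Finset.mul_sum]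
    exact Finset.sum_congr rfl fun i _ => by ring

open Classical in
/-- Linear functions which separate the covectors in the kernel of the Poisson structure. -/
def kernelCoord (P : Pattern) (x : Phase N) : P.Index N → Phase N →ₗ[ℂ] ℂ
  | .inl u => LinearMap.proj (u : Fin N ⊕ Fin N)
  | .inr k => if P.Ev N k then lowMap x k else highMap x k

open Classical in
instance (P : Pattern) : Fintype (P.Index N) := inferInstance

section

variable {P : Pattern} {x : Phase N}

theorem kernelCoord_injective (hP : patternOf x = P) {ξ : Phase N} (hξ : poissonMap x ξ = 0)
    (h : ∀ γ, kernelCoord P x γ ξ = 0) : ξ = 0 := by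
  subst hP
  have hK := (isKernel_iff x ξ).1 hξ
  have h1 := fun k (hk : k < N) => hK.eq_zero (hasPattern x) (fun k hk hact => by
      have h2 := h (.inr ⟨⟨k, by omega⟩, hact⟩)
      simp only [kernelCoord] at h2
      exact ⟨fun he => by simpa [he, lowMap] using h2, fun he => by simpa [he, highMap] using h2⟩)
    (fun k hk hz => by
      have h2 := h (.inl ⟨.inl ⟨k, hk⟩, hz⟩)
      simpa [kernelCoord, seqA, hk] using h2)
    (fun k hk hz => by
      have h2 := h (.inl ⟨.inr ⟨k, hk⟩, hz⟩)
      simpa [kernelCoord, seqB, hk] using h2) hk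
  ext u
  rcases u with j | j
  · simpa using (h1 j j.2).1
  · simpa using (h1 j j.2).2

theorem casimir_ne_zero (hP : patternOf x = P) {k₀ : ℕ} (hact : P.Act N k₀) (hz : P.z k₀) :
    P.casimir N k₀ x ≠ 0 := by
  refine Finset.prod_ne_zero_iff.2 fun u _ => ?_
  by_cases hu : x u = 0
  · simp [exponent_eq_zero hP hact hz u hu]
  · exact zpow_ne_zero _ hu

/-- An active place `k > 0` with `Ω_k ≠ 0` is just above the foot of a slope and carries `Ω_{k-1}`.
At `k = 0` truncated subtraction makes the invariant `Ω_0`. -/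
theorem act_not_z (hP : patternOf x = P) {k : ℕ} (hact : P.Act N k) (hz : ¬ P.z k) :
    k - 1 = 0 ∨ partialSum x (k - 1) = 0 := by
  subst hP
  rcases k with _ | k
  · exact Or.inl rfl
  · right
    simp only [Pattern.Act] at hact
    have : (patternOf x).z k := by tauto
    exact this

theorem poissonMap_grad (hP : patternOf x = P) (γ : P.Index N) :
    poissonMap x (P.grad N γ x) = 0 := by
  rcases γ with u | k
  · exact (isKernel_single (hP ▸ u.2)).poissonMap_eq_zero
  · by_cases hz : P.z k
    · simpa [Pattern.grad, hz] using (isKernel_casimirGrad hP k.2 hz).poissonMap_eq_zero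
    · simpa [Pattern.grad, hz] using
        (isKernel_sumGrad x (by have := k.1.2; omega) (act_not_z hP k.2 hz)).poissonMap_eq_zero

open Classical in
-- Triangularity holds because a monomial's covector has `low = high = 0` below its start, a partial
-- sum's covector has `low = 0`, and a zero coordinate's has both zero.
theorem linearIndependent_grad (hP : patternOf x = P) :
    LinearIndependent ℂ (fun γ => P.grad N γ x) := by
  have hev : ∀ k ≤ N, P.Ev N k → partialSum x k = 0 := by
    subst hP; exact fun k hk => (hasPattern x).sum_eq_zero_of_ev hk
  have hzx : ∀ k, P.z k ↔ partialSum x k = 0 := by subst hP; exact fun k => Iff.rfl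
  have hact0 : ∀ k, P.Act N k → P.z k → ¬ P.Ev N k → k = 0 := by
    intro k hk hz he
    rcases k with _ | k
    · rfl
    · simp only [Pattern.Act] at hk; tauto
  -- Order: monomials by start, then partial sums by place, then zero coordinates; the offsets keep
  -- the three ranges disjoint. By `hact0`, a monomial tested by `high` starts at `0`, where `high`
  -- kills the gradients of the partial sums.
  refine linearIndependent_of_triangular (kernelCoord P x)
    (Sum.elim (fun _ => 2 * N + 3) (fun k => if P.z k then (k : ℕ) else N + 1 + k)) ?_ ?_
  · rintro (u | ⟨⟨k, hk⟩, hact⟩)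
    · simp [kernelCoord, Pattern.grad]
    · have hact' : P.Act N k := hact
      by_cases hz : P.z k
      · have hK := isKernel_casimirGrad hP hact' hz
        have hT := casimir_ne_zero hP hact' hz
        by_cases he : P.Ev N k
        · have := hK.low_eq (show k ≤ N by omega)
          simp [kernelCoord, Pattern.grad, hz, he, lowMap, this, Pattern.lowSgn,
            Pattern.sgn_self, hT]
        · have := hK.high_eq (show k ≤ N by omega)
          simp [kernelCoord, Pattern.grad, hz, he, highMap, this, Pattern.highSgn,
            Pattern.sgn_self, hT]
      · have hK := isKernel_sumGrad x (j := k - 1) (by omega) (act_not_z hP hact' hz)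
        have he : ¬ P.Ev N k := fun h => hz ((hzx k).2 (hev k (by omega) h))
        have := hK.high_eq (show k ≤ N by omega)
        rw [max_eq_right (Nat.sub_le k 1)] at this
        rw [hzx] at hz
        simp [kernelCoord, Pattern.grad, hz, hzx, he, highMap, this]
  · rintro (u | ⟨⟨k, hk⟩, hact⟩) (u' | ⟨⟨k', hk'⟩, hact'⟩) hne hb
    · have : (u : Fin N ⊕ Fin N) ≠ u' := fun h => hne (by rw [Subtype.ext h])
      simp [kernelCoord, Pattern.grad, this]
    · simp only [Sum.elim_inl, Sum.elim_inr] at hb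
      split_ifs at hb <;> omega
    · have hK := isKernel_single (x := x) (u := u'.1) (by rw [hP]; exact u'.2)
      have h1 := hK.high_eq (show k ≤ N by omega)
      have h2 := hK.low_eq (show k ≤ N by omega)
      by_cases he : P.Ev N k
      · simpa [kernelCoord, Pattern.grad, he, lowMap] using h2
      · simpa [kernelCoord, Pattern.grad, he, highMap] using h1
    · have hkk : k' ≠ k := fun h => hne (by subst h; rfl)
      have hact : P.Act N k := hact
      have hact' : P.Act N k' := hact'
      simp only [Sum.elim_inr] at hb
      by_cases hz' : P.z k'
      · have hz : P.z k := by
          by_contra hz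
          simp only [hz, hz', if_true, if_false] at hb
          omega
        simp only [hz, hz', if_true] at hb
        have hlt : k < k' := by omega
        have hK := isKernel_casimirGrad hP hact' hz'
        have h1 := hK.high_eq (show k ≤ N by omega)
        have h2 := hK.low_eq (show k ≤ N by omega)
        by_cases he : P.Ev N k
        · simp [kernelCoord, Pattern.grad, hz', he, lowMap, h2, Pattern.lowSgn,
            Pattern.sgn_of_lt P hlt]
        · simp [kernelCoord, Pattern.grad, hz', he, highMap, h1, Pattern.highSgn,
            Pattern.sgn_of_lt P hlt]
      · have hs := act_not_z hP hact' hz'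
        have hK := isKernel_sumGrad x (j := k' - 1) (by omega) hs
        have h1 := hK.high_eq (show k ≤ N by omega)
        have h2 := hK.low_eq (show k ≤ N by omega)
        by_cases he : P.Ev N k
        · simp [kernelCoord, Pattern.grad, hz', he, lowMap, h2]
        · have hlt : k < k' := by
            by_cases hz : P.z k
            · have := hact0 k hact hz he
              omega
            · simp only [hz, hz', if_false] at hb
              omega
          rw [max_eq_left (by omega)] at h1
          have h3 : partialSum x (k' - 1) = 0 := by
            subst hP
            rcases k' with _ | k'
            · omega
            · simp only [Pattern.Act] at hact'
              have : (patternOf x).z k' := by tauto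
              exact this
          simp [kernelCoord, Pattern.grad, hz', he, highMap, h1, h3]

/-- All the invariants together. -/
def invariants (P : Pattern) (x : Phase N) : P.Index N → ℂ := fun γ => P.invariant N γ x

theorem contDiffAt_invariants (hP : patternOf x = P) : ContDiffAt ℂ ω (invariants (N := N) P) x :=
  contDiffAt_pi.2 fun γ => contDiffAt_invariant hP γ

theorem fderiv_invariants (hP : patternOf x = P) (v : Phase N) (γ : P.Index N) :
    fderiv ℂ (invariants P) x v γ = covector (P.grad N γ x) v := by
  have h1 : HasFDerivAt (invariants P)
      (ContinuousLinearMap.pi fun γ => covector (P.grad N γ x)) x :=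
    hasFDerivAt_pi.2 fun γ => hasFDerivAt_invariant hP γ
  rw [h1.fderiv]
  rfl

theorem fderiv_invariants_surjective (hP : patternOf x = P) :
    Function.Surjective (fderiv ℂ (invariants P) x) := by
  classical
  let A : Matrix (P.Index N) (Fin N ⊕ Fin N) ℂ := Matrix.of fun γ => P.grad N γ x
  have h1 : A.rank = Fintype.card (P.Index N) := (linearIndependent_grad hP).rank_matrix
  have h2 : LinearMap.range A.mulVecLin = ⊤ := by
    apply Submodule.eq_top_of_finrank_eq
    rw [Module.finrank_fintype_fun_eq_card]
    exact h1
  intro c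
  obtain ⟨v, hv⟩ := LinearMap.range_eq_top.1 h2 c
  refine ⟨v, ?_⟩
  ext γ
  rw [fderiv_invariants hP, ← hv, covector_apply]
  rfl

theorem fderiv_invariants_eq_zero (hP : patternOf x = P) {v : Phase N}
    (hv : v ∈ hamiltonianDistribution x) : fderiv ℂ (invariants P) x v = 0 := by
  rw [hamiltonianDistribution_eq_range] at hv
  obtain ⟨c, rfl⟩ := hv
  ext γ
  rw [fderiv_invariants hP, covector_poissonMap, poissonMap_grad hP, map_zero, neg_zero]
  rfl

theorem finrank_phase : Module.finrank ℂ (Phase N) = 2 * N := by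
  simp [two_mul]

theorem finrank_ker_invariants (hP : patternOf x = P) :
    Fintype.card (P.Index N) +
      Module.finrank ℂ (LinearMap.ker (fderiv ℂ (invariants P) x).toLinearMap) = 2 * N := by
  have h1 := (fderiv ℂ (invariants P) x).toLinearMap.finrank_range_add_finrank_ker
  rwa [LinearMap.range_eq_top.2 (fderiv_invariants_surjective hP), finrank_top, finrank_phase,
    Module.finrank_fintype_fun_eq_card] at h1

/-- Inclusion holds because the gradients are in the kernel of the Poisson map. That kernel is
separated by as many functionals as there are invariants, so the distribution is large enough for
equality. -/
theorem hamiltonianDistribution_eq_ker (hP : patternOf x = P) :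
    hamiltonianDistribution x = LinearMap.ker (fderiv ℂ (invariants P) x).toLinearMap := by
  apply Submodule.eq_of_le_of_finrank_le
  · exact fun v hv => fderiv_invariants_eq_zero hP hv
  · have h1 := (poissonMap x).finrank_range_add_finrank_ker
    rw [← hamiltonianDistribution_eq_range, finrank_phase] at h1
    have h2 : Module.finrank ℂ (LinearMap.ker (poissonMap x)) ≤ Fintype.card (P.Index N) := by
      rw [← Module.finrank_fintype_fun_eq_card (R := ℂ)]
      let f : LinearMap.ker (poissonMap x) →ₗ[ℂ] (P.Index N → ℂ) :=
        (LinearMap.pi (kernelCoord P x)).comp (Submodule.subtype _)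
      refine LinearMap.finrank_le_finrank_of_injective (f := f) ?_
      rw [← LinearMap.ker_eq_bot, LinearMap.ker_eq_bot']
      intro ξ hξ
      exact Subtype.ext (kernelCoord_injective hP ξ.2 fun γ => congrFun hξ γ)
    have h3 := finrank_ker_invariants hP
    omega

theorem card_add_finrank (hP : patternOf x = P) : Fintype.card (P.Index N) +
    Module.finrank ℂ (hamiltonianDistribution x) = 2 * N := by
  rw [hamiltonianDistribution_eq_ker hP]
  exact finrank_ker_invariants hP

end

end QPlane
end

/-! ### Leaves as components of the classes -/

noncomputable section
namespace QPlane
open Filter Topology Set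

variable {N : ℕ}

/-- Two points are related if they have the same vanishing pattern and the same invariants. -/
def leafSetoid (N : ℕ) : Setoid (Phase N) where
  r y p := patternOf y = patternOf p ∧ invariants (patternOf p) y = invariants (patternOf p) p
  iseqv := by
    refine ⟨fun p => ⟨rfl, rfl⟩, ?_, ?_⟩
    · rintro y p ⟨h1, h2⟩
      refine ⟨h1.symm, ?_⟩
      rw [h1]
      exact h2.symm
    · rintro y p q ⟨h1, h2⟩ ⟨h3, h4⟩
      refine ⟨h1.trans h3, ?_⟩
      rw [h3] at h2
      exact h2.trans h4

theorem leafSetoid_iff {y p : Phase N} : leafSetoid N y p ↔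
    patternOf y = patternOf p ∧ invariants (patternOf p) y = invariants (patternOf p) p := Iff.rfl

theorem partialSum_of_le (x : Phase N) {k : ℕ} (hk : N ≤ k) : partialSum x k = 0 := by
  rw [partialSum_eq, Finset.Ico_eq_empty (by omega), Finset.sum_empty]

theorem zeroCoord_apply {y : Phase N} {u : Fin N ⊕ Fin N} (h : (patternOf y).ZeroCoord N u) :
    y u = 0 := by
  rcases u with j | j
  · simpa using h.2.2
  · simpa using h.2.2

theorem patternOf_eq {y z : Phase N} (h1 : ∀ k ≤ N, partialSum z k = 0 ↔ partialSum y k = 0)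
    (h2 : ∀ u, (patternOf y).ZeroCoord N u → z u = 0) (h3 : ∀ u, y u ≠ 0 → z u ≠ 0) :
    patternOf z = patternOf y := by
  have h1' : ∀ k, partialSum z k = 0 ↔ partialSum y k = 0 := by
    intro k
    rcases Nat.lt_or_ge N k with h | h
    · simp [partialSum_of_le _ h.le]
    · exact h1 k h
  apply Pattern.ext
  · ext k
    exact h1' k
  · ext k
    simp only [patternOf, h1']
    refine and_congr_right fun h4 => and_congr_right fun h5 => ?_
    by_cases hk : k < N
    · simp only [seqA, hk, dif_pos]
      refine ⟨fun h => by_contra fun h' => h3 _ h' h, fun h => h2 _ ⟨h4, h5, ?_⟩⟩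
      simpa [seqA, hk] using h
    · simp [seqA, hk]
  · ext k
    simp only [patternOf, h1']
    refine and_congr_right fun h4 => and_congr_right fun h5 => ?_
    by_cases hk : k < N
    · simp only [seqB, hk, dif_pos]
      refine ⟨fun h => by_contra fun h' => h3 _ h' h, fun h => h2 _ ⟨h4, h5, ?_⟩⟩
      simpa [seqB, hk] using h
    · simp [seqB, hk]

theorem eventually_ne_zero (y : Phase N) : ∀ᶠ z in 𝓝 y,
    (∀ k ≤ N, partialSum y k ≠ 0 → partialSum z k ≠ 0) ∧ (∀ u, y u ≠ 0 → z u ≠ 0) := by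
  refine Filter.Eventually.and ?_ ?_
  · have : ∀ k ∈ Set.Iic N, ∀ᶠ z in 𝓝 y, partialSum y k ≠ 0 → partialSum z k ≠ 0 := by
      intro k _
      by_cases h : partialSum y k = 0
      · simp [h]
      · filter_upwards [(contDiff_partialSum k).continuous.continuousAt.eventually_ne h] with z hz _
        exact hz
    exact (eventually_all_finite (Set.finite_Iic N)).2 this
  · rw [eventually_all]
    intro u
    by_cases h : y u = 0
    · simp [h]
    · filter_upwards [(continuous_apply u).continuousAt.eventually_ne h] with z hz _
      exact hz

/-- Non-zero values persist nearby, so only zeros need an argument. They are recovered downwards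
from `Ω_N = 0`: at a flat index one recorded coordinate is zero, at the foot of a slope the sum
itself is an invariant. -/
theorem eventually_leafSetoid_iff (y : Phase N) : ∀ᶠ z in 𝓝 y,
    leafSetoid N z y ↔ invariants (patternOf y) z = invariants (patternOf y) y := by
  filter_upwards [eventually_ne_zero y] with z ⟨hz1, hz2⟩
  refine ⟨fun h => h.2, fun h => ⟨?_, h⟩⟩
  have hcoord : ∀ u, (patternOf y).ZeroCoord N u → z u = 0 := by
    intro u hu
    have h1 := congrFun h (.inl ⟨u, hu⟩)
    exact h1.trans (zeroCoord_apply hu)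
  have hsum : ∀ k ≤ N, partialSum y k = 0 → partialSum z k = 0 := by
    refine fun k hk => descending_induction
      (p := fun k => partialSum y k = 0 → partialSum z k = 0)
      (fun _ => partialSum_top z) (fun k hk ih h0 => ?_) k hk
    by_cases h1 : partialSum y (k + 1) = 0
    · have h2 := partialSum_step y hk
      rw [h0, h1, add_zero, zero_eq_mul] at h2
      rw [partialSum_step z hk, ih h1, add_zero, mul_eq_zero]
      refine h2.imp (fun h2 => ?_) (fun h2 => ?_)
      · have h3 := hcoord (.inl ⟨k, hk⟩) ⟨h0, h1, h2⟩
        simpa [seqA, hk] using h3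
      · have h3 := hcoord (.inr ⟨k, hk⟩) ⟨h0, h1, h2⟩
        simpa [seqB, hk] using h3
    · have hz : ¬ (patternOf y).z (k + 1) := h1
      have hact : (patternOf y).Act N (k + 1) := Or.inr ⟨h1, h0⟩
      have h2 := congrFun h (.inr ⟨⟨k + 1, by omega⟩, hact⟩)
      simp only [invariants, Pattern.invariant, hz, if_false, Nat.add_sub_cancel] at h2
      rw [h2, h0]
  exact patternOf_eq (fun k hk => ⟨fun h0 => by_contra fun h' => hz1 k hk h' h0, hsum k hk⟩)
    hcoord hz2

theorem exists_flattening_leafSetoid {y p : Phase N} {r : ℕ} (h : leafSetoid N y p)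
    (hr : Fintype.card ((patternOf p).Index N) + r = 2 * N) :
    ∃ φ : OpenPartialHomeomorph (Phase N) (((patternOf p).Index N → ℂ) × (Fin r → ℂ)),
      Flattening {y | leafSetoid N y p} (hamiltonianDistribution y) y φ := by
  obtain ⟨h1, h2⟩ := leafSetoid_iff.1 h
  refine exists_flattening (invariants (patternOf p)) (contDiffAt_invariants h1)
    (fderiv_invariants_surjective h1) (fun v => ?_) ?_ ?_
  · rw [hamiltonianDistribution_eq_ker h1]; rfl
  · rw [finrank_phase, Module.finrank_fintype_fun_eq_card, Module.finrank_fintype_fun_eq_card,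
      Fintype.card_fin, hr]
  · filter_upwards [eventually_leafSetoid_iff y] with z hz
    rw [h1] at hz
    rw [← hz]
    exact ⟨fun hz => (leafSetoid N).trans hz ((leafSetoid N).symm h),
      fun hz => (leafSetoid N).trans hz h⟩

theorem continuous_seqA (k : ℕ) : Continuous fun x : Phase N => seqA x k := by
  by_cases h : k < N
  · simpa [seqA, h] using continuous_apply _
  · simpa [seqA, h] using continuous_const

theorem continuous_seqB (k : ℕ) : Continuous fun x : Phase N => seqB x k := by
  by_cases h : k < N
  · simpa [seqB, h] using continuous_apply _
  · simpa [seqB, h] using continuous_const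

theorem continuous_low (ξ : Phase N) (k : ℕ) : Continuous fun x : Phase N => low x ξ k :=
  continuous_finsetSum _ fun i _ =>
    (continuous_const.mul (continuous_seqB i)).sub (continuous_const.mul (continuous_seqA i))

theorem continuous_high (ξ : Phase N) (k : ℕ) : Continuous fun x : Phase N => high x ξ k :=
  continuous_finsetSum _ fun i _ =>
    (continuous_const.mul (continuous_seqA i)).add (continuous_const.mul (continuous_seqB i))

/-- `poissonMap` as a continuous linear map. -/
def poissonCLM (x : Phase N) : Phase N →L[ℂ] Phase N := LinearMap.toContinuousLinearMap (poissonMap x)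

theorem continuous_poissonCLM : Continuous (poissonCLM (N := N)) := by
  refine continuous_clm_apply.2 fun ξ => continuous_pi fun v => ?_
  change Continuous fun x => poissonMap x ξ v
  rcases v with j | j
  · simp only [poissonMap_inl]
    exact ((continuous_seqA _).mul ((continuous_low _ _).add (continuous_high _ _))).sub
      (continuous_const.mul (contDiff_partialSum _).continuous)
  · simp only [poissonMap_inr]
    exact (continuous_const.mul (contDiff_partialSum _).continuous).sub
      ((continuous_seqB _).mul ((continuous_high _ _).sub (continuous_low _ _)))

/-- `low + high` as a continuous linear function of the covector. -/
def lowAddHigh (k : ℕ) (x : Phase N) : Phase N →L[ℂ] ℂ :=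
  LinearMap.toContinuousLinearMap (lowMap x k + highMap x (k + 1))

/-- `low - high` as a continuous linear function of the covector. -/
def lowSubHigh (k : ℕ) (x : Phase N) : Phase N →L[ℂ] ℂ :=
  LinearMap.toContinuousLinearMap (lowMap x k - highMap x (k + 1))

theorem continuous_lowAddHigh (k : ℕ) : Continuous (lowAddHigh (N := N) k) :=
  continuous_clm_apply.2 fun ξ => (continuous_low ξ k).add (continuous_high ξ (k + 1))

theorem continuous_lowSubHigh (k : ℕ) : Continuous (lowSubHigh (N := N) k) :=
  continuous_clm_apply.2 fun ξ => (continuous_low ξ k).sub (continuous_high ξ (k + 1))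

/-- `low` as a continuous linear function of the covector. -/
def lowCLM (k : ℕ) (x : Phase N) : Phase N →L[ℂ] ℂ :=
  LinearMap.toContinuousLinearMap ((2 : ℂ) • lowMap x k)

theorem continuous_lowCLM (k : ℕ) : Continuous (lowCLM (N := N) k) :=
  continuous_clm_apply.2 fun ξ => continuous_const.mul (continuous_low ξ k)

/-- The derivative of `a_j a_j^*` is `2 (Ω_j low_j - Ω_{j+1} low_{j+1})`, which telescopes. -/
theorem fderiv_partialSum_poissonMap {k : ℕ} (hk : k ≤ N) (x c : Phase N) :
    fderiv ℂ (fun x : Phase N => partialSum x k) x (poissonCLM x c) =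
      partialSum x k * lowCLM k x c := by
  rw [(hasFDerivAt_partialSum k x).fderiv]
  change covector _ (poissonMap x c) = partialSum x k * (2 * low x c k)
  let g : ℕ → ℂ := fun j =>
    2 * (partialSum x j * low x c j - partialSum x (j + 1) * low x c (j + 1))
  have h1 : covector (Pattern.sumGrad N k x) (poissonMap x c) =
      ∑ j : Fin N, if k ≤ (j : ℕ) then g j else 0 := by
    rw [covector_apply, Fintype.sum_sum_type, ← Finset.sum_add_distrib]
    refine Finset.sum_congr rfl fun j _ => ?_
    by_cases hj : k ≤ (j : ℕ)
    · have h2 := partialSum_step x j.2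
      have h3 : low x c (j + 1) = low x c j +
          (seqB c j * seqB x j - seqA c j * seqA x j) := by
        rw [low, low, Finset.sum_range_succ]
      simp only [Pattern.sumGrad, hj, if_true, poissonMap_inl, poissonMap_inr, g, h2, h3]
      simp only [seqA_coe, seqB_coe]
      ring
    · simp [Pattern.sumGrad, hj]
  have h2 : ∀ k ≤ N, ∑ j ∈ Finset.Ico k N, g j = 2 * (partialSum x k * low x c k) := by
    refine fun k hk => descending_induction
      (p := fun k => ∑ j ∈ Finset.Ico k N, g j = 2 * (partialSum x k * low x c k)) ?_ ?_ k hk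
    · simp [partialSum_top]
    · intro k hk ih
      rw [Finset.sum_eq_sum_Ico_succ_bot hk, ih]
      simp only [g]; ring
  have h3 : (Finset.range N).filter (fun j => k ≤ j) = Finset.Ico k N := by
    ext i; simp only [Finset.mem_range, Finset.mem_filter, Finset.mem_Ico]; omega
  rw [h1, sum_fin_ite (fun j => k ≤ j) g, h3, h2 k hk]
  ring

theorem apply_poissonCLM_inl {x : Phase N} {j : Fin N} (h : partialSum x (j + 1) = 0)
    (c : Phase N) : poissonCLM x c (.inl j) = x (.inl j) * lowAddHigh j x c := by
  have := poissonMap_inl x c j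
  rw [h, mul_zero, sub_zero, seqA_coe] at this
  exact this

theorem apply_poissonCLM_inr {x : Phase N} {j : Fin N} (h : partialSum x (j + 1) = 0)
    (c : Phase N) : poissonCLM x c (.inr j) = x (.inr j) * lowSubHigh j x c := by
  have h1 := poissonMap_inr x c j
  rw [h, mul_zero, zero_sub, seqB_coe, ← mul_neg, neg_sub] at h1
  exact h1

/-- Zeros of the sums must be propagated first: the derivative of a coordinate at `j` is a multiple
of that coordinate only while `Ω_{j+1} = 0`. -/
theorem eventually_patternOf_eq {r : ℕ} {ι : (Fin r → ℂ) → Phase N} {w₀ : Fin r → ℂ}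
    {O : Set (Fin r → ℂ)} (hO : IsOpen O) (hw₀ : w₀ ∈ O) (hι : ContDiffOn ℂ ω ι O)
    (hinj : ∀ w ∈ O, Function.Injective (fderiv ℂ ι w))
    (hrange : ∀ w ∈ O, ∀ v, (∃ e, fderiv ℂ ι w e = v) ↔ v ∈ hamiltonianDistribution (ι w)) :
    ∀ᶠ w in 𝓝 w₀, patternOf (ι w) = patternOf (ι w₀) := by
  have hrange' : ∀ w ∈ O, ∀ v, (∃ e, fderiv ℂ ι w e = v) ↔ ∃ c, poissonCLM (ι w) c = v := by
    intro w hw v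
    rw [hrange w hw, hamiltonianDistribution_eq_range]
    rfl
  have hcont : ContinuousAt ι w₀ := hι.continuousOn.continuousAt (hO.mem_nhds hw₀)
  have hsum : ∀ k ≤ N, partialSum (ι w₀) k = 0 → ∀ᶠ w in 𝓝 w₀, partialSum (ι w) k = 0 := by
    intro k hk h0
    exact eventually_eq_zero_of_fderiv_eq_mul hO hw₀ hι continuous_poissonCLM hinj hrange'
      (h := fun x => partialSum x k) ((contDiff_partialSum k).differentiable (by simp))
      (continuous_lowCLM k)
      (Eventually.of_forall fun w c => fderiv_partialSum_poissonMap hk (ι w) c) h0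
  have hfd : ∀ (u : Fin N ⊕ Fin N) (x v : Phase N), fderiv ℂ (fun x : Phase N => x u) x v = v u := by
    intro u x v
    exact congrArg (fun f => f v) (ContinuousLinearMap.proj (R := ℂ)
      (φ := fun _ : Fin N ⊕ Fin N => ℂ) u).fderiv
  have hcoord : ∀ u, (patternOf (ι w₀)).ZeroCoord N u → ∀ᶠ w in 𝓝 w₀, ι w u = 0 := by
    intro u hu
    have h0 := zeroCoord_apply hu
    rcases u with j | j
    · have h1 := hsum (j + 1) j.2 hu.2.1
      refine eventually_eq_zero_of_fderiv_eq_mul hO hw₀ hι continuous_poissonCLM hinj hrange'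
        (h := fun x => x (.inl j)) (differentiable_apply _) (continuous_lowAddHigh j) ?_ h0
      filter_upwards [h1] with w hw c
      rw [hfd, apply_poissonCLM_inl hw]
    · have h1 := hsum (j + 1) j.2 hu.2.1
      refine eventually_eq_zero_of_fderiv_eq_mul hO hw₀ hι continuous_poissonCLM hinj hrange'
        (h := fun x => x (.inr j)) (differentiable_apply _) (continuous_lowSubHigh j) ?_ h0
      filter_upwards [h1] with w hw c
      rw [hfd, apply_poissonCLM_inr hw]
  have hsum' : ∀ᶠ w in 𝓝 w₀, ∀ k ∈ Set.Iic N, partialSum (ι w₀) k = 0 → partialSum (ι w) k = 0 := by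
    rw [eventually_all_finite (Set.finite_Iic N)]
    intro k hk
    by_cases h : partialSum (ι w₀) k = 0
    · filter_upwards [hsum k hk h] with w hw _
      exact hw
    · simp [h]
  have hcoord' : ∀ᶠ w in 𝓝 w₀, ∀ u, (patternOf (ι w₀)).ZeroCoord N u → ι w u = 0 := by
    rw [eventually_all]
    intro u
    by_cases h : (patternOf (ι w₀)).ZeroCoord N u
    · filter_upwards [hcoord u h] with w hw _
      exact hw
    · simp [h]
  filter_upwards [hsum', hcoord', hcont.eventually (eventually_ne_zero (ι w₀))] with w h1 h2 h3
  exact patternOf_eq (fun k hk => ⟨fun h => by_contra fun h' => h3.1 k hk h' h, h1 k hk⟩) h2 h3.2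

theorem eventually_leafSetoid (L : IntegralManifold N) (q : L.M) :
    letI := L.top
    ∀ᶠ q' in 𝓝 q, leafSetoid N (L.incl q') (L.incl q) := by
  obtain ⟨ι, w₀, O, hO, hw₀, hι, hq, hinj, hrange, hP⟩ := L.exists_parametrization q
  refine hP (fun y => leafSetoid N y (L.incl q)) ?_
  rw [← hq]
  have hpat := eventually_patternOf_eq hO hw₀ hι hinj hrange
  have hιd : ∀ w ∈ O, DifferentiableAt ℂ ι w := fun w hw =>
    (hι.contDiffAt (hO.mem_nhds hw)).differentiableAt (by simp)
  have hinv : ∀ᶠ w in 𝓝 w₀, invariants (patternOf (ι w₀)) (ι w) =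
      invariants (patternOf (ι w₀)) (ι w₀) := by
    -- Constancy of the pattern is needed here: it makes the monomials differentiable, with
    -- derivative zero on the distribution, at all nearby points.
    refine eventually_eq_of_fderiv_eq_zero (f := fun w => invariants (patternOf (ι w₀)) (ι w)) ?_ ?_
    · filter_upwards [hpat, hO.mem_nhds hw₀] with w h1 h2
      exact ((contDiffAt_invariants h1).differentiableAt (by simp)).comp w (hιd w h2)
    · filter_upwards [hpat, hO.mem_nhds hw₀] with w h1 h2
      have h3 := fderiv_comp w ((contDiffAt_invariants h1).differentiableAt (by simp)) (hιd w h2)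
      refine h3.trans ?_
      ext1 e
      exact fderiv_invariants_eq_zero h1 ((hrange w h2 _).1 ⟨e, rfl⟩)
  filter_upwards [hpat, hinv] with w h1 h2
  exact ⟨h1, h2⟩

theorem exists_symplecticLeaf (x : Phase N) :
    ∃ L : IntegralManifold N, L.IsSymplecticLeaf ∧ x ∈ L.points := by
  have hr := card_add_finrank (rfl : patternOf x = patternOf x)
  refine exists_leaf (K := (patternOf x).Index N → ℂ)
    (r := Module.finrank ℂ (hamiltonianDistribution x)) (leafSetoid N) x eventually_leafSetoid
    (fun y hy => exists_flattening_leafSetoid hy hr) (fun y hy => ?_)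
  have := card_add_finrank (leafSetoid_iff.1 hy).1
  omega

end QPlane
end

/-! ### Counting dimensions block by block -/

noncomputable section
namespace QPlane

variable {N : ℕ}

open Classical in
/-- The number of non-zero coordinates with index `j`. -/
def coordCount (x : Phase N) (j : ℕ) : ℕ :=
  (if seqA x j ≠ 0 then 1 else 0) + (if seqB x j ≠ 0 then 1 else 0)

open Classical in
/-- The contribution of the index `j` to the dimension of the leaf through `x`. -/
def weight (x : Phase N) (j : ℕ) : ℕ :=
  if partialSum x (j + 1) = 0 then
    if partialSum x j = 0 then coordCount x j else if (patternOf x).Ev N (j + 1) then 1 else 2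
  else if partialSum x j = 0 then 1 else 2

open Classical in
theorem nonzeroCount_eq (x : Phase N) (S : Set ℕ) :
    nonzeroCount x S = ∑ j ∈ (Finset.range N).filter (· ∈ S), coordCount x j := by
  rw [Finset.sum_filter, ← Fin.sum_univ_eq_sum_range (fun j => if j ∈ S then coordCount x j else 0),
    nonzeroCount, Finset.card_filter, Finset.card_filter, ← Finset.sum_add_distrib]
  refine Finset.sum_congr rfl fun j _ => ?_
  by_cases h : (j : ℕ) ∈ S <;> simp [h, coordCount]

theorem nonzeroCount_eq_sum_Ico (x : Phase N) {S : Set ℕ} {m n : ℕ}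
    (h : ∀ j < N, j ∈ S ↔ m ≤ j ∧ j < n) (hn : n ≤ N) :
    nonzeroCount x S = ∑ j ∈ Finset.Ico m n, coordCount x j := by
  classical
  rw [nonzeroCount_eq]
  congr 1
  ext j
  simp only [Finset.mem_filter, Finset.mem_range, Finset.mem_Ico]
  constructor
  · rintro ⟨h1, h2⟩
    exact (h j h1).1 h2
  · intro h1
    exact ⟨by omega, (h j (by omega)).2 h1⟩

open Classical in
-- Index `j` is charged for its recorded zero coordinates and for the active place `j + 1`, and
-- `weight` is what remains of `2`. The place `0` is charged to no index, hence the correction.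
theorem card_index_add_sum_weight (x : Phase N) :
    Fintype.card ((patternOf x).Index N) + ∑ j ∈ Finset.range N, weight x j =
      2 * N + if (patternOf x).Ev N 0 then 0 else 1 := by
  set P := patternOf x with hP
  have h1 : Fintype.card {u : Fin N ⊕ Fin N // P.ZeroCoord N u} =
      ∑ j ∈ Finset.range N, ((if P.za j then 1 else 0) + (if P.zb j then 1 else 0)) := by
    rw [Fintype.card_subtype, Finset.card_filter, Fintype.sum_sum_type,
      ← Fin.sum_univ_eq_sum_range (fun j => (if P.za j then 1 else 0) + (if P.zb j then 1 else 0)),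
      Finset.sum_add_distrib]
    rfl
  have h2 : Fintype.card {k : Fin (N + 1) // P.Act N k} =
      ∑ j ∈ Finset.range N, (if P.Act N (j + 1) then 1 else 0) +
        if P.Ev N 0 then 0 else 1 := by
    rw [Fintype.card_subtype, Finset.card_filter,
      Fin.sum_univ_eq_sum_range (fun k => if P.Act N k then 1 else 0), Finset.sum_range_succ']
    congr 1
    by_cases h : P.Ev N 0 <;> simp [Pattern.Act, h]
  rw [Fintype.card_sum, h1, h2]
  have h3 : ∀ j ∈ Finset.range N, ((if P.za j then 1 else 0) + (if P.zb j then 1 else 0)) +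
      (if P.Act N (j + 1) then 1 else 0) + weight x j = 2 := by
    intro j hj
    have hj := Finset.mem_range.1 hj
    have hza : P.za j ↔ partialSum x j = 0 ∧ partialSum x (j + 1) = 0 ∧ seqA x j = 0 := Iff.rfl
    have hzb : P.zb j ↔ partialSum x j = 0 ∧ partialSum x (j + 1) = 0 ∧ seqB x j = 0 := Iff.rfl
    have hz0 : P.z j ↔ partialSum x j = 0 := Iff.rfl
    have hz1 : P.z (j + 1) ↔ partialSum x (j + 1) = 0 := Iff.rfl
    simp only [hza, hzb, Pattern.Act, hz0, hz1, weight, coordCount]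
    by_cases h0 : partialSum x j = 0 <;> by_cases h1 : partialSum x (j + 1) = 0
    · by_cases h2 : seqA x j = 0 <;> by_cases h3 : seqB x j = 0 <;> simp [h0, h1, h2, h3]
    · simp [h0, h1]
    · by_cases h2 : P.Ev N (j + 1) <;> simp [h0, h1, h2, ← hP]
    · simp [h0, h1]
  have h4 := Finset.sum_congr rfl h3
  simp only [Finset.sum_add_distrib, Finset.sum_const, Finset.card_range, smul_eq_mul] at h4 ⊢
  omega

open Classical in
theorem finrank_add_eq (x : Phase N) : Module.finrank ℂ (hamiltonianDistribution x) +
    (if (patternOf x).Ev N 0 then 0 else 1) = ∑ j ∈ Finset.range N, weight x j := by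
  have h1 := card_index_add_sum_weight x
  have h2 := card_add_finrank (rfl : patternOf x = patternOf x)
  omega

theorem ev_iff (x : Phase N) {k : ℕ} (hk : k < N) : (patternOf x).Ev N k ↔
    partialSum x k = 0 ∧ (partialSum x (k + 1) = 0 →
      ((patternOf x).Single k ↔ ¬ (patternOf x).Ev N (k + 1))) :=
  (patternOf x).ev_iff N hk

theorem sum_weight_flat (x : Phase N) {n : ℕ} (hn : n ≤ N) (hev : (patternOf x).Ev N n) {m : ℕ}
    (hm : m ≤ n) (h : ∀ j, m ≤ j → j ≤ n → partialSum x j = 0) :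
    ∑ j ∈ Finset.Ico m n, weight x j = ∑ j ∈ Finset.Ico m n, coordCount x j ∧
    ((patternOf x).Ev N m ↔ Even (∑ j ∈ Finset.Ico m n, coordCount x j)) := by
  refine descending_induction (p := fun m => (∀ j, m ≤ j → j ≤ n → partialSum x j = 0) →
    ∑ j ∈ Finset.Ico m n, weight x j = ∑ j ∈ Finset.Ico m n, coordCount x j ∧
    ((patternOf x).Ev N m ↔ Even (∑ j ∈ Finset.Ico m n, coordCount x j))) ?_ ?_ m hm h
  · intro _
    simpa using hev
  · intro k hk ih h
    obtain ⟨ih1, ih2⟩ := ih fun j hj => h j (by omega)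
    have h0 := h k le_rfl hk.le
    have h1 := h (k + 1) (by omega) hk
    have hs := partialSum_step x (show k < N by omega)
    have hsingle : (patternOf x).Single k ↔ ¬ Even (coordCount x k) := by
      rw [h0, h1, add_zero, zero_eq_mul] at hs
      simp only [Pattern.Single, Pattern.Flat, patternOf, h0, h1, coordCount]
      by_cases ha : seqA x k = 0 <;> by_cases hb : seqB x k = 0 <;> simp_all
    rw [Finset.sum_eq_sum_Ico_succ_bot hk, Finset.sum_eq_sum_Ico_succ_bot hk, ih1,
      Nat.even_add, ← ih2, ev_iff x (by omega)]
    refine ⟨by simp [weight, h0, h1], ?_⟩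
    rw [hsingle]
    tauto

/-- The cusp has weight `1` or `2` according as the run above it has an even or odd number of
non-zero coordinates; this produces the rounding. -/
theorem sum_weight_flat_cusp (x : Phase N) {n : ℕ} (hn : n ≤ N) (hev : (patternOf x).Ev N n)
    {m : ℕ} (hm : m < n) (h : ∀ j, m < j → j ≤ n → partialSum x j = 0) (h0 : partialSum x m ≠ 0) :
    ∑ j ∈ Finset.Ico m n, weight x j =
      2 * ((∑ j ∈ Finset.Ico (m + 1) n, coordCount x j + 1) / 2) + 1 := by
  obtain ⟨h1, h2⟩ := sum_weight_flat x hn hev (show m + 1 ≤ n from hm) fun j hj => h j hj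
  have hw : weight x m = if Even (∑ j ∈ Finset.Ico (m + 1) n, coordCount x j) then 1 else 2 := by
    simp [weight, h (m + 1) (by omega) hm, h0, h2]
  rw [Finset.sum_eq_sum_Ico_succ_bot hm, h1, hw]
  split_ifs with h3
  · obtain ⟨r, hr⟩ := h3
    omega
  · obtain ⟨r, hr⟩ := Nat.not_even_iff_odd.1 h3
    omega

theorem sum_weight_slope (x : Phase N) {m n : ℕ}
    (h : ∀ j, m ≤ j → j ≤ n → partialSum x j ≠ 0) :
    ∑ j ∈ Finset.Ico m n, weight x j = 2 * (n - m) := by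
  rw [Finset.sum_congr rfl (g := fun _ => 2)]
  · simp [mul_comm]
  · intro j hj
    rw [Finset.mem_Ico] at hj
    simp [weight, h j hj.1 hj.2.le, h (j + 1) (by omega) hj.2]

/-- The upper end of the `k`-th block of indices. -/
def blockTop (N : ℕ) (i : ℕ → ℕ) (k : ℕ) : ℕ := if k = 0 then N else i (2 * k - 1)

section blocks

variable {x : Phase N} {s : ℕ} {i : ℕ → ℕ}

theorem IsIndexSequence.cusp (h : IsIndexSequence x s i) {t : ℕ} (ht : 2 * t ≤ s) :
    blockTop N i t ≤ N ∧ i (2 * t) < blockTop N i t ∧ partialSum x (i (2 * t)) ≠ 0 ∧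
      ∀ j, i (2 * t) < j → j ≤ blockTop N i t → partialSum x j = 0 := by
  have hbase : i 0 < N ∧ partialSum x (i 0) ≠ 0 ∧ ∀ j, i 0 < j → j ≤ N → partialSum x j = 0 := by
    obtain ⟨⟨j₀, hj₀, hne⟩, hub⟩ := h.first
    have hz : ∀ j, i 0 < j → j ≤ N → partialSum x j = 0 := by
      intro j hj hjN
      refine descending_induction (p := fun j => i 0 < j → partialSum x j = 0)
        (fun _ => partialSum_top x) ?_ j hjN hj
      intro k hk ih hik
      rw [partialSum_step x hk, ih (by omega), add_zero]
      by_contra hne'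
      have : k ≤ i 0 := hub ⟨⟨k, hk⟩, rfl, by simpa [seqA, seqB, hk] using hne'⟩
      omega
    have hi : i 0 < N := hj₀ ▸ j₀.2
    refine ⟨hi, ?_, hz⟩
    rw [partialSum_step x hi, hz (i 0 + 1) (by omega) hi, add_zero, ← hj₀]
    simpa using hne
  have hle : ∀ t, 2 * t ≤ s → i (2 * t) < N := by
    intro t
    induction t with
    | zero => exact fun _ => hbase.1
    | succ t ih =>
      intro ht
      have h1 := (h.odd_step t (by omega)).1.1
      have h2 := (h.even_step t (by omega)).1.1
      have h3 := ih (by omega)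
      rw [show 2 * (t + 1) = 2 * t + 2 by ring]
      omega
  rcases t with _ | t
  · exact ⟨le_rfl, hbase⟩
  · have h1 := h.even_step t (by omega)
    have h2 := (h.odd_step t (by omega)).1
    have h3 := hle t (by omega)
    have htop : blockTop N i (t + 1) = i (2 * t + 1) := by
      simp [blockTop, show 2 * (t + 1) - 1 = 2 * t + 1 by omega]
    rw [htop, show 2 * (t + 1) = 2 * t + 2 by ring]
    refine ⟨by have := h2.1; omega, h1.1.1, h1.1.2, fun j hj hj' => ?_⟩
    rcases hj'.lt_or_eq with hlt | rfl
    · by_contra hne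
      have := h1.2 ⟨hlt, hne⟩
      omega
    · exact h2.2

theorem IsIndexSequence.rEven_eq (h : IsIndexSequence x s i) {t : ℕ} (ht : 2 * t ≤ s) :
    rEven x i t = ∑ j ∈ Finset.Ico (i (2 * t) + 1) (blockTop N i t), coordCount x j := by
  refine nonzeroCount_eq_sum_Ico x (fun j hj => ?_) (h.cusp ht).1
  by_cases h0 : t = 0
  · simp [blockTop, h0, hj]
  · simp [blockTop, h0]

theorem IsIndexSequence.sum_weight_cusp (h : IsIndexSequence x s i) {t : ℕ} (ht : 2 * t ≤ s)
    (hev : (patternOf x).Ev N (blockTop N i t)) :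
    ∑ j ∈ Finset.Ico (i (2 * t)) (blockTop N i t), weight x j =
      2 * ((rEven x i t + 1) / 2) + 1 := by
  obtain ⟨h1, h2, h3, h4⟩ := h.cusp ht
  rw [sum_weight_flat_cusp x h1 hev h2 h4 h3, h.rEven_eq ht]

/-- The foot of the slope has weight `1`, which pairs with the odd unit left by the cusp. It also
resets the state to even, so the next block starts like the first. -/
theorem IsIndexSequence.sum_weight_odd (h : IsIndexSequence x s i) {t : ℕ} (ht : 2 * t + 1 ≤ s)
    (hev : (patternOf x).Ev N (blockTop N i t)) :
    ∑ j ∈ Finset.Ico (i (2 * t + 1)) (blockTop N i t), weight x j =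
      2 * (i (2 * t) - i (2 * t + 1)) + 2 * ((rEven x i t + 1) / 2) ∧
    (patternOf x).Ev N (blockTop N i (t + 1)) := by
  obtain ⟨⟨h1, h2⟩, h3⟩ := h.odd_step t ht
  obtain ⟨hc1, hc2, hc3, hc4⟩ := h.cusp (show 2 * t ≤ s by omega)
  have hslope : ∀ j, i (2 * t + 1) + 1 ≤ j → j ≤ i (2 * t) → partialSum x j ≠ 0 := by
    intro j hj hj' h0
    rcases hj'.lt_or_eq with hlt | rfl
    · have := h3 ⟨hlt, h0⟩
      omega
    · exact hc3 h0
  have hne := hslope _ le_rfl h1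
  have htop : blockTop N i (t + 1) = i (2 * t + 1) := by
    simp [blockTop, show 2 * (t + 1) - 1 = 2 * t + 1 by omega]
  constructor
  · rw [← Finset.sum_Ico_consecutive _ h1.le hc2.le, h.sum_weight_cusp (by omega) hev,
      Finset.sum_eq_sum_Ico_succ_bot h1, sum_weight_slope x hslope]
    simp only [weight, h2, hne, if_true, if_false]
    omega
  · rw [htop, ev_iff x (by omega)]
    exact ⟨h2, fun h => absurd h hne⟩

theorem IsIndexSequence.sum_weight_blocks (h : IsIndexSequence x s i) {t : ℕ} (ht : 2 * t ≤ s + 1) :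
    ∑ j ∈ Finset.Ico (blockTop N i t) N, weight x j =
      ∑ k ∈ Finset.range t, (2 * (i (2 * k) - i (2 * k + 1)) + 2 * ((rEven x i k + 1) / 2)) ∧
    (patternOf x).Ev N (blockTop N i t) := by
  induction t with
  | zero => simp [blockTop, (patternOf x).ev_top N]
  | succ t ih =>
    obtain ⟨ih1, ih2⟩ := ih (by omega)
    obtain ⟨h1, h2⟩ := h.sum_weight_odd (t := t) (by omega) ih2
    obtain ⟨hc1, hc2, -, -⟩ := h.cusp (show 2 * t ≤ s by omega)
    have htop : blockTop N i (t + 1) = i (2 * t + 1) := by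
      simp [blockTop, show 2 * (t + 1) - 1 = 2 * t + 1 by omega]
    have h3 := (h.odd_step t (by omega)).1.1
    refine ⟨?_, h2⟩
    rw [Finset.sum_range_succ, ← ih1, ← h1, htop,
      ← Finset.sum_Ico_consecutive _ (by omega : i (2 * t + 1) ≤ blockTop N i t) hc1, add_comm]

end blocks

/-- In the lowest flat run the correction at place `0` is the parity of the coordinate count, so the
count is rounded down to an even number. -/
theorem finrank_of_flat (x : Phase N) {n : ℕ} (hn : n ≤ N) (hev : (patternOf x).Ev N n)
    (h : ∀ j ≤ n, partialSum x j = 0) : Module.finrank ℂ (hamiltonianDistribution x) =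
      ∑ j ∈ Finset.Ico n N, weight x j + 2 * (nonzeroCount x {j | j < n} / 2) := by
  have h1 := finrank_add_eq x
  obtain ⟨h2, h3⟩ := sum_weight_flat x hn hev (Nat.zero_le n) fun j _ hj => h j hj
  rw [Finset.range_eq_Ico, ← Finset.sum_Ico_consecutive _ (Nat.zero_le n) hn, h2] at h1
  rw [nonzeroCount_eq_sum_Ico x (m := 0) (n := n) (by simp) hn]
  rw [h3] at h1
  split_ifs at h1 with h4
  · obtain ⟨r, hr⟩ := h4
    omega
  · obtain ⟨r, hr⟩ := Nat.not_even_iff_odd.1 h4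
    omega

theorem finrank_of_forall_mul_eq_zero (x : Phase N)
    (h : ∀ j : Fin N, x (.inl j) * x (.inr j) = 0) :
    Module.finrank ℂ (hamiltonianDistribution x) = 2 * (nonzeroCount x Set.univ / 2) := by
  have h0 : ∀ j ≤ N, partialSum x j = 0 := by
    intro j _
    exact Finset.sum_eq_zero fun i _ => h i
  rw [finrank_of_flat x le_rfl ((patternOf x).ev_top N) h0,
    nonzeroCount_eq_sum_Ico x (m := 0) (n := N) (by simp) le_rfl,
    nonzeroCount_eq_sum_Ico x (S := Set.univ) (m := 0) (n := N) (by simp) le_rfl]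
  simp

theorem IsIndexSequence.finrank_even {x : Phase N} {l : ℕ} {i : ℕ → ℕ}
    (h : IsIndexSequence x (2 * l) i) : Module.finrank ℂ (hamiltonianDistribution x) =
      ∑ k ∈ Finset.range (l + 1),
        (2 * (i (2 * k) - i (2 * k + 1)) + 2 * ((rEven x i k + 1) / 2)) := by
  obtain ⟨h1, hev⟩ := h.sum_weight_blocks (t := l) (by omega)
  obtain ⟨hc1, hc2, hc3, hc4⟩ := h.cusp le_rfl
  have hne : ∀ j, 0 ≤ j → j ≤ i (2 * l) → partialSum x j ≠ 0 := by
    intro j _ hj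
    rcases hj.lt_or_eq with hlt | rfl
    · exact h.stop_even l rfl j hlt
    · exact hc3
  have hev0 : ¬ (patternOf x).Ev N 0 := (hasPattern x).not_ev_of_ne (Nat.zero_le N)
    (hne 0 le_rfl (Nat.zero_le _))
  have h2 := finrank_add_eq x
  rw [if_neg hev0, Finset.range_eq_Ico,
    ← Finset.sum_Ico_consecutive _ (Nat.zero_le (i (2 * l))) (by omega : i (2 * l) ≤ N),
    ← Finset.sum_Ico_consecutive _ hc2.le hc1, h.sum_weight_cusp le_rfl hev, h1,
    sum_weight_slope x hne] at h2
  -- The lowest slope reaches `0`, matching the convention `i_{2l+1} = 0`; the correction at place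
  -- `0` cancels the odd unit of the last cusp.
  rw [Finset.sum_range_succ, h.beyond (2 * l + 1) (by omega)]
  omega

theorem IsIndexSequence.finrank_odd {x : Phase N} {l : ℕ} {i : ℕ → ℕ}
    (h : IsIndexSequence x (2 * l + 1) i) : Module.finrank ℂ (hamiltonianDistribution x) =
      (∑ k ∈ Finset.range (l + 1), 2 * (i (2 * k) - i (2 * k + 1))) +
        ((∑ k ∈ Finset.range (l + 1), 2 * ((rEven x i k + 1) / 2)) +
          2 * (nonzeroCount x {j | j < i (2 * l + 1)} / 2)) := by
  obtain ⟨h1, hev⟩ := h.sum_weight_blocks (t := l + 1) (by omega)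
  have htop : blockTop N i (l + 1) = i (2 * l + 1) := by
    simp [blockTop, show 2 * (l + 1) - 1 = 2 * l + 1 by omega]
  rw [htop] at h1 hev
  obtain ⟨hlt, h0⟩ := (h.odd_step l le_rfl).1
  obtain ⟨hc1, hc2, -, -⟩ := h.cusp (show 2 * l ≤ 2 * l + 1 by omega)
  rw [finrank_of_flat x (by omega) hev, h1, Finset.sum_add_distrib, add_assoc]
  intro j hj
  rcases hj.lt_or_eq with hj | rfl
  · exact h.stop_odd l rfl j hj
  · exact h0

end QPlane
end

/-- Through every point `x` of `ℂ^{2N}` there is a symplectic leaf, and the dimension of the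
symplectic leaf through `x` is given by the three formulas below. -/
theorem mainTheorem5 (N : ℕ) (x : QPlane.Phase N) :
    (∃ L : QPlane.IntegralManifold N, L.IsSymplecticLeaf ∧ x ∈ L.points) ∧
    ∀ L : QPlane.IntegralManifold N, L.IsSymplecticLeaf → x ∈ L.points →
      ((∀ j : Fin N, x (.inl j) * x (.inr j) = 0) →
        L.dim = 2 * (QPlane.nonzeroCount x Set.univ / 2)) ∧
      (∀ (l : ℕ) (i : ℕ → ℕ), QPlane.IsIndexSequence x (2 * l) i →
        L.dim = ∑ k ∈ Finset.range (l + 1),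
          (2 * (i (2 * k) - i (2 * k + 1)) + 2 * ((QPlane.rEven x i k + 1) / 2))) ∧
      (∀ (l : ℕ) (i : ℕ → ℕ), QPlane.IsIndexSequence x (2 * l + 1) i →
        L.dim = (∑ k ∈ Finset.range (l + 1), 2 * (i (2 * k) - i (2 * k + 1))) +
          ((∑ k ∈ Finset.range (l + 1), 2 * ((QPlane.rEven x i k + 1) / 2)) +
            2 * (QPlane.nonzeroCount x {j | j < i (2 * l + 1)} / 2))) := by
  refine ⟨QPlane.exists_symplecticLeaf x, ?_⟩
  rintro L - ⟨p, rfl⟩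
  rw [L.dim_eq p]
  exact ⟨QPlane.finrank_of_forall_mul_eq_zero _, fun l i h => h.finrank_even,
    fun l i h => h.finrank_odd⟩
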